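/- Let $k\ge 1$ be a fixed integer and let $G_n=(V_n,U_n,E_n)$, $n\in\mathbb N$, be finite simple bipartite graphs with sides $V_n\neq\emptyset$ and $U_n$ that are $C_4$-free (any two distinct vertices have at most one common neighbour) and $(d,k+1)$-bi-regular: every $v\in V_n$ has degree $d=d(n)$ and every $u\in U_n$ has degree $k+1$, where $d(n)\to\infty$ as $n\to\infty$. Let $B_n$ be a signed adjacency matrix of $G_n$, that is, a $V_n\times U_n$ matrix with entries in $\{1,-1\}$ at the edges of $G_n$ and $0$ elsewhere. Let $H_n\subset\mathbb R^{U_n}$ be the row space of $B_n$ and $P_{H_n}$ the orthogonal projection onto $H_n$. Let $\mathcal T=\mathcal T_n\subset U_n$ be a random set of size $\operatorname{rank}(B_n)$ with law $\mathbb P(\mathcal T=T)=\det\big((P_{H_n})_{u,u'\in T}\big)$ for $|T|=\operatorname{rank}(B_n)$, and let $o$ be a uniform vertex of $V_n$ independent of $\mathcal T$. For $T\subset U_n$ let $G_n[T]$ be the subgraph of $G_n$ induced by $T$ and all neighbours of vertices of $T$, and let $B_{\mathcal T}(o,r)$ be the subgraph of $G_n[\mathcal T]$ induced by its vertices at graph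 distance at most $r$ from $o$ in $G_n[\mathcal T]$; $|B_{\mathcal T}(o,r)|$ is its number of vertices. Let $\psi_1,\dots,\psi_{\operatorname{rank}(B_n)}\in\mathbb R^{U_n}$ be orthonormal eigenvectors of $L^-=\frac1d B_n^TB_n$ corresponding to its positive eigenvalues $\lambda_1,\dots,\lambda_{\operatorname{rank}(B_n)}$ (listed with multiplicity). Let $\epsilon=\epsilon(n)>0$ and $\delta=\delta(n)>0$ satisfy $\epsilon\to0$, $\epsilon d\to\infty$, $\delta d\to0$ and $\epsilon\delta d^2\to\infty$ as $n\to\infty$, and let $$U_{\epsilon,\delta}=\Big\{u\in U_n:\ \sum_{i:(\lambda_i-1)^2>\epsilon}\psi_i(u)^2>\delta\Big\}.$$ Then for every fixed integer $r>0$: 1. $\displaystyle\lim_{t\to\infty}\limsup_{n\to\infty}\mathbb P\big(|B_{\mathcal T}(o,r)|>t\big)=0$; 2. $\displaystyle\lim_{n\to\infty}\mathbb P\big(B_{\mathcal T}(o,r)\text{ is a tree}\big)=1$; 3. $\displaystyle\lim_{n\to\infty}\mathbb P\big(B_{\mathcal T}(o,r)\cap U_{\epsilon,\delta}\neq\emptyset\big)=0$.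 -/

import Mathlib

open Filter Topology

namespace DetProc

/-! ### Determinantal probability measures -/

section Determinantal

variable {U : Type*} [Fintype U] [DecidableEq U]

/-- The matrix, in the standard basis, of the orthogonal projection onto `H`. -/
noncomputable def projMatrix (H : Submodule ℝ (EuclideanSpace ℝ U)) : Matrix U U ℝ :=
  Matrix.of fun u u' => H.starProjection (EuclideanSpace.single u' (1 : ℝ)) u

/-- The weight of `T` under the determinantal measure of `H`: the determinant of the principal
submatrix of the projection matrix indexed by `T` if `|T| = dim H`, and `0` otherwise. -/
noncomputable def detWeight (H : Submodule ℝ (EuclideanSpace ℝ U)) (T : Finset U) : ℝ :=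
  if T.card = Module.finrank ℝ H then
    ((projMatrix H).submatrix (Subtype.val : T → U) (Subtype.val : T → U)).det
  else 0

theorem exists_projMatrix_eq (H : Submodule ℝ (EuclideanSpace ℝ U)) :
    ∃ C : Matrix (Fin (Module.finrank ℝ H)) U ℝ,
      projMatrix H = C.transpose * C ∧ C * C.transpose = 1 := by
  let b := stdOrthonormalBasis ℝ H
  refine ⟨Matrix.of fun i u => (b i : EuclideanSpace ℝ U) u, ?_, ?_⟩
  · ext u u'
    simp [projMatrix, b.starProjection_eq_sum_rankOne, Matrix.mul_apply, EuclideanSpace.inner_single_right, mul_comm]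
  · ext i j
    have h := orthonormal_iff_ite.mp b.orthonormal j i
    rw [Submodule.coe_inner, PiLp.inner_apply] at h
    simp only [RCLike.inner_apply, conj_trivial] at h
    simp only [Matrix.mul_apply, Matrix.transpose_apply, Matrix.of_apply, Matrix.one_apply]
    rw [h]
    simp [eq_comm]

theorem detWeight_nonneg (H : Submodule ℝ (EuclideanSpace ℝ U)) (T : Finset U) :
    0 ≤ detWeight H T := by
  unfold detWeight
  split_ifs
  · obtain ⟨C, hC, -⟩ := exists_projMatrix_eq H
    have h : (projMatrix H).PosSemidef := by
      rw [hC]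
      simpa using Matrix.posSemidef_conjTranspose_mul_self C
    exact (h.submatrix _).det_nonneg
  · exact le_rfl

theorem sum_detWeight (H : Submodule ℝ (EuclideanSpace ℝ U)) :
    ∑ T : Finset U, detWeight H T = 1 := by
  obtain ⟨C, hC, hC'⟩ := exists_projMatrix_eq H
  have h := Matrix.coeff_det_one_add_X_smul_eq_sum_minors (projMatrix H) (Module.finrank ℝ H)
  have h2 : ∑ T : Finset U, detWeight H T =
      ∑ s ∈ Finset.univ.powersetCard (Module.finrank ℝ H),
        ((projMatrix H).submatrix (Subtype.val : s → U) (Subtype.val : s → U)).det := by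
    rw [Finset.powersetCard_eq_filter, Finset.powerset_univ, Finset.sum_filter]
    rfl
  rw [h2, ← h, hC, Matrix.map_mul, ← Matrix.smul_mul, Matrix.det_one_add_mul_comm,
    Matrix.mul_smul, ← Matrix.map_mul, hC']
  rw [Matrix.map_one _ (map_zero _) (map_one _)]
  have : (1 : Matrix (Fin (Module.finrank ℝ H)) (Fin (Module.finrank ℝ H)) (Polynomial ℝ))
      + (Polynomial.X : Polynomial ℝ) • 1
      = (1 + Polynomial.X : Polynomial ℝ) • 1 := by
    rw [add_smul, one_smul]
  rw [this, Matrix.det_smul, Matrix.det_one, mul_one, Fintype.card_fin,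
    Polynomial.coeff_one_add_X_pow]
  simp

/-- The determinantal probability measure associated with the subspace `H`. -/
noncomputable def detPMF (H : Submodule ℝ (EuclideanSpace ℝ U)) : PMF (Finset U) :=
  PMF.ofFintype (fun T => ENNReal.ofReal (detWeight H T)) (by
    rw [← ENNReal.ofReal_sum_of_nonneg fun T _ => detWeight_nonneg H T, sum_detWeight,
      ENNReal.ofReal_one])

end Determinantal

/-- The row space of a real matrix. -/
def rowSpace {V U : Type*} (B : Matrix V U ℝ) : Submodule ℝ (EuclideanSpace ℝ U) :=
  Submodule.span ℝ (Set.range fun v => WithLp.toLp 2 (B.row v))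

/-- The joint law of `(o, 𝒯)`, where `o` is uniform in `V` and `𝒯` is an independent sample of
the determinantal measure associated with the row space of `B`. -/
noncomputable def jointLaw {V U : Type*} [Fintype V] [Nonempty V] [Fintype U] [DecidableEq U]
    (B : Matrix V U ℝ) : PMF (V × Finset U) :=
  (PMF.uniformOfFintype V).bind fun o => (detPMF (rowSpace B)).map fun T => (o, T)

/-- The probability that `(o, 𝒯)` satisfies `E`. -/
noncomputable def prob {V U : Type*} [Fintype V] [Nonempty V] [Fintype U] [DecidableEq U]
    (B : Matrix V U ℝ) (E : V → Finset U → Prop) : ENNReal :=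
  (jointLaw B).toOuterMeasure {p | E p.1 p.2}

/-! ### Bipartite graphs -/

section Graph

variable {V U : Type*}

/-- `G` is bipartite with sides `V`, `U`, it is `(d, k + 1)`-bi-regular, and any two distinct
vertices have at most one common neighbour (it is `C₄`-free). -/
structure IsBiregularC4Free (G : SimpleGraph (V ⊕ U)) (d k : ℕ) : Prop where
  bipartite : G ≤ completeBipartiteGraph V U
  degree_left : ∀ v : V, (G.neighborSet (Sum.inl v)).ncard = d
  degree_right : ∀ u : U, (G.neighborSet (Sum.inr u)).ncard = k + 1
  c4_free : ∀ x y : V ⊕ U, x ≠ y → (G.commonNeighbors x y).Subsingleton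

/-- `B` is a signed adjacency matrix of `G`. -/
def IsSignedAdjMatrix (G : SimpleGraph (V ⊕ U)) (B : Matrix V U ℝ) : Prop :=
  ∀ v u, (G.Adj (Sum.inl v) (Sum.inr u) → B v u = 1 ∨ B v u = -1) ∧
    (¬ G.Adj (Sum.inl v) (Sum.inr u) → B v u = 0)

/-- The vertex set `N_G(T) ∪ T` of `G[T]`. -/
def inducedVerts (G : SimpleGraph (V ⊕ U)) (T : Finset U) : Set (V ⊕ U) :=
  {x | ∃ u ∈ T, x = Sum.inr u ∨ G.Adj (Sum.inr u) x}

/-- The vertex set of the ball `B_T(o, r)`: the vertices of `G[T]` at distance at most `r` from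
`o` in the graph `G[T] = G.induce (inducedVerts G T)`. (It is empty if `o` is not a vertex of
`G[T]`.) -/
def sampleBall (G : SimpleGraph (V ⊕ U)) (T : Finset U) (o : V) (r : ℕ) : Set (V ⊕ U) :=
  {x | ∃ (ho : Sum.inl o ∈ inducedVerts G T) (hx : x ∈ inducedVerts G T),
    (G.induce (inducedVerts G T)).edist ⟨Sum.inl o, ho⟩ ⟨x, hx⟩ ≤ r}

/-- The ball `B_T(o, r)` as a graph. It is an induced subgraph of `G[T]`, which is itself
an induced subgraph of `G`. -/
def sampleBallGraph (G : SimpleGraph (V ⊕ U)) (T : Finset U) (o : V) (r : ℕ) :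
    SimpleGraph (sampleBall G T o r) :=
  G.induce (sampleBall G T o r)

end Graph

/-! ### Structured vertices -/

section Structured

variable {V U : Type*} [Fintype V] [Fintype U]

/-- The operator `L⁻ = (1/d) Bᵀ B`. -/
noncomputable def lapMinus (d : ℕ) (B : Matrix V U ℝ) : Matrix U U ℝ :=
  (d : ℝ)⁻¹ • (B.transpose * B)

/-- `ψ` is a family of `rank B` orthonormal eigenvectors of `L⁻`, with positive eigenvalues
`lam`. -/
structure IsPositiveEigensystem (d : ℕ) (B : Matrix V U ℝ) (lam : Fin B.rank → ℝ)
    (ψ : Fin B.rank → EuclideanSpace ℝ U) : Prop where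
  orthonormal : Orthonormal ℝ ψ
  pos : ∀ i, 0 < lam i
  eigen : ∀ i, (lapMinus d B).mulVec (ψ i) = lam i • (ψ i : U → ℝ)

/-- The set of `(ε, δ)`-structured vertices. -/
noncomputable def structuredSet {ι : Type*} [Fintype ι] (lam : ι → ℝ)
    (ψ : ι → EuclideanSpace ℝ U) (ε δ : ℝ) : Set U :=
  {u | δ < ∑ i with ε < (lam i - 1) ^ 2, (ψ i u) ^ 2}

end Structured

end DetProc

/-! The sample 𝒯 is negatively correlated: P(S ⊆ 𝒯) ≤ ∏_{u ∈ S} p_u with p_u = (P_H)_{uu}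
(`sum_detWeight_superset_le`). Suppose every p_u were O(1/d). Exploring from o, there are at most
(Ad)^m ways to add m vertices of U one at a time, each outcome being present with probability
O(d^{-m}), so the expected number of explored sets is bounded; this gives tightness. A cycle forces
one more sampled vertex adjacent to two vertices already reached. C₄-freeness leaves boundedly many
candidates for it instead of order d, so cycles cost an extra factor O(1/d).

The bound on p_u is spectral. C₄-freeness makes tr (L⁻)² independent of the signs, and the first two
traces give ∑ (λ_i - 1)² + (|V| - rank B) = |V| k/d (`IsPositiveEigensystem.sum_sq_sub_one`).
Eigenvalues with (λ - 1)² ≤ ε ≤ 1/4 contribute at most 2 L⁻_{uu} = 2(k+1)/d to p_u; the others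
contribute at most δ ≤ 1/d when u is outside U_{ε,δ}. Vertices outside U_{ε,δ} are thus good.

The expected number of sampled bad vertices is o(|V|) (`IsPositiveEigensystem.sum_structured_le`). A
bad vertex nearest to o is joined to o through good vertices only, so summing over bad vertices
instead of roots (mass transport) shows that the ball meets U_{ε,δ} with probability o(1)
(`realProb_not_good_le`). Finally, o must lie in G[𝒯] for its ball to be a tree: a sample touches at
least rank B vertices of V (`rank_le_card_covered`), so o is missed with probability at most k/d. -/

namespace DetProc

/-! ### Determinantal measures: generating function and negative correlation. -/

section Determinantal

/-- **Hadamard's inequality** for a square real matrix: the squared determinant is at most the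
product of the squared norms of the columns. -/
theorem sq_det_le_prod_col {n : ℕ} (N : Matrix (Fin n) (Fin n) ℝ) :
    N.det ^ 2 ≤ ∏ j, ∑ i, N i j ^ 2 := by
  have : Fact (Module.finrank ℝ (EuclideanSpace ℝ (Fin n)) = n) := ⟨by simp⟩
  let b := EuclideanSpace.basisFun (Fin n) ℝ
  let v : Fin n → EuclideanSpace ℝ (Fin n) := fun j => WithLp.toLp 2 fun i => N i j
  have h := b.toBasis.orientation.abs_volumeForm_apply_le v
  rw [b.toBasis.orientation.volumeForm_robust b rfl, Module.Basis.det_apply] at h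
  have hm : b.toBasis.toMatrix v = N := by
    ext i j
    simp [Module.Basis.toMatrix_apply, b, v]
  rw [hm] at h
  have h2 := pow_le_pow_left₀ (abs_nonneg _) h 2
  rw [sq_abs, ← Finset.prod_pow] at h2
  refine h2.trans_eq (Finset.prod_congr rfl fun j _ => ?_)
  rw [EuclideanSpace.norm_eq, Real.sq_sqrt (Finset.sum_nonneg fun _ _ => sq_nonneg _)]
  simp [v]

open scoped MatrixOrder Matrix.Norms.L2Operator in
/-- **Hadamard's inequality** for positive semidefinite matrices. -/
theorem det_le_prod_diag {ι : Type*} [Fintype ι] [DecidableEq ι] {A : Matrix ι ι ℝ}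
    (hA : A.PosSemidef) : A.det ≤ ∏ i, A i i := by
  let e := Fintype.equivFin ι
  have hA' : (A.submatrix e.symm e.symm).PosSemidef := hA.submatrix _
  obtain ⟨N, hN⟩ := CStarAlgebra.nonneg_iff_eq_star_mul_self.mp hA'.nonneg
  rw [Matrix.star_eq_conjTranspose] at hN
  have h := sq_det_le_prod_col N
  have hdet : A.det = N.det ^ 2 := by
    rw [← Matrix.det_submatrix_equiv_self e.symm A, hN, Matrix.det_mul,
      Matrix.det_conjTranspose, star_trivial, sq]
  rw [hdet]
  refine h.trans_eq ?_
  rw [← Equiv.prod_comp e.symm]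
  refine Finset.prod_congr rfl fun j _ => ?_
  have := congrFun (congrFun hN j) j
  simp only [Matrix.submatrix_apply] at this
  rw [this, Matrix.mul_apply]
  simp [sq]

variable {U : Type*} [Fintype U] [DecidableEq U]

/-- The probability generating function of a determinantal measure. -/
theorem sum_detWeight_mul_prod (H : Submodule ℝ (EuclideanSpace ℝ U))
    {C : Matrix (Fin (Module.finrank ℝ H)) U ℝ} (hC : projMatrix H = C.transpose * C)
    (x : U → ℝ) :
    ∑ T : Finset U, detWeight H T * ∏ u ∈ T, x u =
      (C * Matrix.diagonal x * C.transpose).det := by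
  -- Both sides are the coefficient of `X ^ finrank H` in det(1 + X D CᵀC) = det(1 + X C D Cᵀ),
  -- where D = diag(x). Since C D Cᵀ has size `finrank H`, its only principal minor of that order is
  -- its determinant.
  have h := Matrix.coeff_det_one_add_X_smul_eq_sum_minors (Matrix.diagonal x * projMatrix H) (Module.finrank ℝ H)
  have h2 := Matrix.coeff_det_one_add_X_smul_eq_sum_minors
    (C * Matrix.diagonal x * C.transpose) (Module.finrank ℝ H)
  have h3 : (Finset.univ : Finset (Fin (Module.finrank ℝ H))).powersetCard (Module.finrank ℝ H) = {Finset.univ} := by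
    simpa using Finset.powersetCard_self (Finset.univ : Finset (Fin (Module.finrank ℝ H)))
  rw [h3, Finset.sum_singleton] at h2
  have h4 : ((C * Matrix.diagonal x * C.transpose).submatrix
      (Subtype.val : ↥(Finset.univ : Finset (Fin (Module.finrank ℝ H))) → Fin (Module.finrank ℝ H)) Subtype.val).det =
      (C * Matrix.diagonal x * C.transpose).det :=
    Matrix.det_submatrix_equiv_self (Equiv.subtypeUnivEquiv (fun i => Finset.mem_univ i)) _
  rw [← h4, ← h2]
  have h5 : ∑ T : Finset U, detWeight H T * ∏ u ∈ T, x u =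
      ∑ s ∈ Finset.univ.powersetCard (Module.finrank ℝ H), ((Matrix.diagonal x * projMatrix H).submatrix
        (Subtype.val : s → U) (Subtype.val : s → U)).det := by
    rw [Finset.powersetCard_eq_filter, Finset.powerset_univ, Finset.sum_filter]
    refine Finset.sum_congr rfl fun T _ => ?_
    unfold detWeight
    split_ifs with hT
    · have : (Matrix.diagonal x * projMatrix H).submatrix (Subtype.val : T → U)
          (Subtype.val : T → U) = Matrix.diagonal (fun u : T => x u) *
            (projMatrix H).submatrix (Subtype.val : T → U) (Subtype.val : T → U) := by
        ext i j
        simp [Matrix.diagonal_mul]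
      rw [this, Matrix.det_mul, Matrix.det_diagonal, mul_comm, Finset.prod_coe_sort]
    · simp
  rw [h5, ← h, hC, ← Matrix.mul_assoc, Matrix.map_mul, ← Matrix.smul_mul,
    Matrix.det_one_add_mul_comm, Matrix.mul_smul, ← Matrix.map_mul, Matrix.mul_assoc]

/-- The left side is E (1 + t)^{|𝒯 ∩ S|}. For these weights C D Cᵀ = 1 + t C_S C_Sᵀ because C Cᵀ =
1, and Sylvester's identity moves the determinant to size |S|. -/
theorem sum_detWeight_mul_one_add_pow (H : Submodule ℝ (EuclideanSpace ℝ U)) (S : Finset U)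
    (t : ℝ) :
    ∑ T : Finset U, detWeight H T * ∏ u ∈ T, (if u ∈ S then 1 + t else 1) =
      (1 + t • (projMatrix H).submatrix (Subtype.val : S → U) Subtype.val).det := by
  obtain ⟨C, hC, hC'⟩ := exists_projMatrix_eq H
  rw [sum_detWeight_mul_prod H hC]
  let CS : Matrix (Fin (Module.finrank ℝ H)) S ℝ := C.submatrix id Subtype.val
  have h1 : C * Matrix.diagonal (fun u => if u ∈ S then 1 + t else 1) * C.transpose =
      1 + CS * (t • CS.transpose) := by
    rw [← hC']
    ext i j
    rw [Matrix.mul_apply]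
    simp only [Matrix.mul_diagonal]
    simp only [Matrix.mul_apply, Matrix.add_apply, Matrix.transpose_apply,
      Matrix.smul_apply, CS, Matrix.submatrix_apply, id, smul_eq_mul]
    rw [Finset.sum_coe_sort S (fun u => C i u * (t * C j u)), ← Finset.sum_filter_add_sum_filter_not
      Finset.univ (· ∈ S) (fun u => C i u * C j u), ← Finset.sum_filter_add_sum_filter_not
      Finset.univ (· ∈ S)]
    simp only [Finset.filter_univ_mem]
    rw [add_right_comm, ← Finset.sum_add_distrib]
    congr 1
    · refine Finset.sum_congr rfl fun u hu => ?_
      rw [if_pos hu]; ring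
    · refine Finset.sum_congr rfl fun u hu => ?_
      rw [if_neg (Finset.mem_filter.mp hu).2]; ring
  rw [h1, Matrix.det_one_add_mul_comm, Matrix.smul_mul]
  congr 3
  ext i j
  simp [CS, hC, Matrix.mul_apply]

theorem projMatrix_posSemidef (H : Submodule ℝ (EuclideanSpace ℝ U)) :
    (projMatrix H).PosSemidef := by
  obtain ⟨C, hC, -⟩ := exists_projMatrix_eq H
  rw [hC]
  simpa using Matrix.posSemidef_conjTranspose_mul_self C

/-- Negative correlation of the presence of points in a determinantal sample. -/
theorem sum_detWeight_superset_le (H : Submodule ℝ (EuclideanSpace ℝ U)) (S : Finset U) :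
    ∑ T : Finset U, (if S ⊆ T then detWeight H T else 0) ≤ ∏ u ∈ S, projMatrix H u u := by
  -- Keeping only T ⊇ S bounds E (1 + t)^{|𝒯 ∩ S|} below by t^{|S|} P(S ⊆ 𝒯); Hadamard bounds it
  -- above by ∏ (1 + t p_u). Dividing by t^{|S|} leaves an error t⁻¹ in each factor, which vanishes
  -- as t → ∞.
  have key : ∀ t : ℝ, 0 < t → ∑ T : Finset U, (if S ⊆ T then detWeight H T else 0) ≤
      ∏ u ∈ S, (t⁻¹ + projMatrix H u u) := by
    intro t ht
    have h1 : (1 + t • (projMatrix H).submatrix (Subtype.val : S → U) Subtype.val).PosSemidef :=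
      Matrix.PosSemidef.one.add (((projMatrix_posSemidef H).submatrix _).smul ht.le)
    have h2 := det_le_prod_diag h1
    rw [← sum_detWeight_mul_one_add_pow] at h2
    simp only [Matrix.add_apply, Matrix.one_apply_eq, Matrix.smul_apply, Matrix.submatrix_apply,
      smul_eq_mul] at h2
    rw [Finset.prod_coe_sort S (fun u => 1 + t * projMatrix H u u)] at h2
    have h3 : t ^ S.card * ∑ T : Finset U, (if S ⊆ T then detWeight H T else 0) ≤
        ∑ T : Finset U, detWeight H T * ∏ u ∈ T, (if u ∈ S then 1 + t else 1) := by
      rw [Finset.mul_sum]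
      refine Finset.sum_le_sum fun T _ => ?_
      have hp : ∀ u ∈ T, (1 : ℝ) ≤ if u ∈ S then 1 + t else 1 := by
        intro u _; split_ifs <;> linarith
      split_ifs with hST
      · rw [mul_comm]
        refine mul_le_mul_of_nonneg_left ?_ (detWeight_nonneg H T)
        calc t ^ S.card ≤ ∏ u ∈ S, (if u ∈ S then 1 + t else 1) := by
              rw [← Finset.prod_const]
              refine Finset.prod_le_prod (fun _ _ => ht.le) fun u hu => ?_
              rw [if_pos hu]; linarith
          _ ≤ _ := Finset.prod_le_prod_of_subset_of_one_le hST
              (fun u hu => zero_le_one.trans (hp u (hST hu))) fun u hu _ => hp u hu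
      · rw [mul_zero]
        exact mul_nonneg (detWeight_nonneg H T)
          (Finset.prod_nonneg fun u hu => zero_le_one.trans (hp u hu))
    have h4 : ∏ u ∈ S, (1 + t * projMatrix H u u) =
        t ^ S.card * ∏ u ∈ S, (t⁻¹ + projMatrix H u u) := by
      rw [← Finset.prod_const, ← Finset.prod_mul_distrib]
      refine Finset.prod_congr rfl fun u _ => ?_
      rw [mul_add, mul_inv_cancel₀ ht.ne']
    rw [h4] at h2
    exact le_of_mul_le_mul_left (h3.trans h2) (pow_pos ht _)
  have hlim : Tendsto (fun t : ℝ => ∏ u ∈ S, (t⁻¹ + projMatrix H u u)) atTop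
      (𝓝 (∏ u ∈ S, (0 + projMatrix H u u))) :=
    tendsto_finsetProd _ fun u _ => tendsto_inv_atTop_zero.add_const _
  simp only [zero_add] at hlim
  exact ge_of_tendsto hlim ((eventually_gt_atTop 0).mono key)

end Determinantal

/-! ### Spectral decomposition of L⁻ on the row space. -/

section Spectral

variable {V U : Type*} [Fintype V] [Fintype U]

omit [Fintype U] in
theorem toLp_vecMul_mem_rowSpace (B : Matrix V U ℝ) (w : V → ℝ) :
    WithLp.toLp 2 (B.transpose.mulVec w) ∈ rowSpace B := by
  have : WithLp.toLp 2 (B.transpose.mulVec w) = ∑ v, w v • WithLp.toLp 2 (B.row v) := by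
    ext u
    simp [Matrix.mulVec, dotProduct, mul_comm]
  rw [this]
  exact Submodule.sum_mem _ fun v _ =>
    Submodule.smul_mem _ _ (Submodule.subset_span ⟨v, rfl⟩)

theorem finrank_rowSpace (B : Matrix V U ℝ) :
    Module.finrank ℝ (rowSpace B) = B.rank := by
  rw [Matrix.rank_eq_finrank_span_row]
  have : rowSpace B = (Submodule.span ℝ (Set.range B.row)).map
      (WithLp.linearEquiv 2 ℝ (U → ℝ)).symm.toLinearMap := by
    rw [Submodule.map_span, ← Set.range_comp]
    rfl
  rw [this]
  exact LinearEquiv.finrank_map_eq _ _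

variable {d : ℕ} {B : Matrix V U ℝ} {lam : Fin B.rank → ℝ}
  {ψ : Fin B.rank → EuclideanSpace ℝ U}

theorem IsPositiveEigensystem.mem_rowSpace (h : IsPositiveEigensystem d B lam ψ)
    (i : Fin B.rank) : ψ i ∈ rowSpace B := by
  have h1 := h.eigen i
  have h2 : ψ i = WithLp.toLp 2
      (B.transpose.mulVec (((lam i)⁻¹ * (d : ℝ)⁻¹) • B.mulVec (ψ i))) := by
    ext u
    have h3 := congrFun h1 u
    simp only [lapMinus, Matrix.smul_mulVec, Pi.smul_apply, smul_eq_mul] at h3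
    rw [← Matrix.mulVec_mulVec] at h3
    simp only [Matrix.mulVec_smul, Pi.smul_apply, smul_eq_mul]
    rw [mul_assoc, h3, inv_mul_cancel_left₀ (h.pos i).ne']
  rw [h2]
  exact toLp_vecMul_mem_rowSpace B _

theorem IsPositiveEigensystem.span_eq (h : IsPositiveEigensystem d B lam ψ) :
    Submodule.span ℝ (Set.range ψ) = rowSpace B := by
  apply Submodule.eq_of_le_of_finrank_eq
  · rw [Submodule.span_le]
    rintro _ ⟨i, rfl⟩
    exact h.mem_rowSpace i
  · rw [finrank_span_eq_card h.orthonormal.linearIndependent, finrank_rowSpace, Fintype.card_fin]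

variable [DecidableEq U]

theorem IsPositiveEigensystem.projMatrix_apply (h : IsPositiveEigensystem d B lam ψ) (u u' : U) :
    projMatrix (rowSpace B) u u' = ∑ i, ψ i u * ψ i u' := by
  have h1 : (rowSpace B).starProjection (EuclideanSpace.single u' (1 : ℝ)) =
      ∑ i, ψ i u' • ψ i := by
    refine Submodule.eq_starProjection_of_mem_of_inner_eq_zero
      (Submodule.sum_mem _ fun i _ => Submodule.smul_mem _ _ (h.mem_rowSpace i)) ?_
    intro w hw
    rw [← h.span_eq] at hw
    induction hw using Submodule.span_induction with
    | mem x hx =>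
      obtain ⟨j, rfl⟩ := hx
      rw [inner_sub_left, sum_inner]
      simp only [inner_smul_left, orthonormal_iff_ite.mp h.orthonormal]
      simp [EuclideanSpace.inner_single_left]
    | zero => simp
    | add x y _ _ hx hy => rw [inner_add_right, hx, hy, add_zero]
    | smul a x _ hx => rw [inner_smul_right, hx, mul_zero]
  simp only [projMatrix, Matrix.of_apply, h1]
  simp [mul_comm]

theorem projMatrix_mulVec (H : Submodule ℝ (EuclideanSpace ℝ U)) (x : EuclideanSpace ℝ U) :
    (projMatrix H).mulVec x = H.starProjection x := by
  ext u
  have h2 : x = ∑ u', x u' • EuclideanSpace.single u' (1 : ℝ) := by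
    ext w
    simp [Finset.sum_apply, Pi.single_apply]
  conv_rhs => rw [h2, map_sum]
  simp [Matrix.mulVec, dotProduct, projMatrix, mul_comm]

/-- The matrix whose columns are the eigenvectors. -/
noncomputable def eigMatrix {ι : Type*} (ψ : ι → EuclideanSpace ℝ U) : Matrix U ι ℝ :=
  Matrix.of fun u i => ψ i u

omit [DecidableEq U] in
theorem eigMatrix_transpose_mul {ι : Type*} [DecidableEq ι] {ψ : ι → EuclideanSpace ℝ U}
    (h : Orthonormal ℝ ψ) : (eigMatrix ψ).transpose * eigMatrix ψ = 1 := by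
  ext i j
  have h1 := orthonormal_iff_ite.mp h j i
  rw [PiLp.inner_apply] at h1
  simp only [RCLike.inner_apply, conj_trivial] at h1
  simp only [Matrix.mul_apply, Matrix.transpose_apply, eigMatrix, Matrix.of_apply,
    Matrix.one_apply]
  rw [h1]
  simp [eq_comm]

omit [Fintype V] in
theorem mul_projMatrix_rowSpace (B : Matrix V U ℝ) : B * projMatrix (rowSpace B) = B := by
  have hs : (projMatrix (rowSpace B)).transpose = projMatrix (rowSpace B) := by
    obtain ⟨C, hC, -⟩ := exists_projMatrix_eq (rowSpace B)
    rw [hC]; simp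
  ext v u
  have hv : WithLp.toLp 2 (B.row v) ∈ rowSpace B := Submodule.subset_span ⟨v, rfl⟩
  have h := congrFun (projMatrix_mulVec (rowSpace B) (WithLp.toLp 2 (B.row v))) u
  rw [Submodule.starProjection_eq_self_iff.mpr hv] at h
  rw [← hs] at h
  simp only [Matrix.mulVec, dotProduct, Matrix.transpose_apply] at h
  rw [Matrix.mul_apply]
  simpa [mul_comm] using h

/-- The projection fixes the rows of B, so L⁻ = L⁻P with P = ΨΨᵀ, and L⁻Ψ = ΨΛ. The kernel of L⁻
never has to be described. -/
theorem IsPositiveEigensystem.lapMinus_eq (h : IsPositiveEigensystem d B lam ψ) :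
    lapMinus d B = eigMatrix ψ * Matrix.diagonal lam * (eigMatrix ψ).transpose := by
  have hP : projMatrix (rowSpace B) = eigMatrix ψ * (eigMatrix ψ).transpose := by
    ext u u'
    simp [h.projMatrix_apply, Matrix.mul_apply, eigMatrix]
  have h1 : lapMinus d B = lapMinus d B * projMatrix (rowSpace B) := by
    rw [lapMinus, Matrix.smul_mul, Matrix.mul_assoc, mul_projMatrix_rowSpace]
  rw [h1, hP, ← Matrix.mul_assoc]
  congr 1
  ext u i
  have := congrFun (h.eigen i) u
  rw [Matrix.mul_diagonal, Matrix.mul_apply]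
  simpa [Matrix.mulVec, dotProduct, eigMatrix, mul_comm] using this

theorem IsPositiveEigensystem.lapMinus_diag (h : IsPositiveEigensystem d B lam ψ) (u : U) :
    lapMinus d B u u = ∑ i, lam i * ψ i u ^ 2 := by
  rw [h.lapMinus_eq, Matrix.mul_apply]
  refine Finset.sum_congr rfl fun i _ => ?_
  rw [Matrix.mul_diagonal]
  simp only [eigMatrix, Matrix.of_apply, Matrix.transpose_apply]
  ring

theorem IsPositiveEigensystem.trace_lapMinus (h : IsPositiveEigensystem d B lam ψ) :
    (lapMinus d B).trace = ∑ i, lam i := by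
  rw [h.lapMinus_eq, Matrix.mul_assoc, Matrix.trace_mul_comm, Matrix.mul_assoc,
    eigMatrix_transpose_mul h.orthonormal, Matrix.mul_one, Matrix.trace_diagonal]

theorem IsPositiveEigensystem.trace_lapMinus_sq (h : IsPositiveEigensystem d B lam ψ) :
    (lapMinus d B * lapMinus d B).trace = ∑ i, lam i ^ 2 := by
  have : lapMinus d B * lapMinus d B =
      eigMatrix ψ * (Matrix.diagonal lam * Matrix.diagonal lam * (eigMatrix ψ).transpose) := by
    rw [h.lapMinus_eq]
    calc _ = eigMatrix ψ * (Matrix.diagonal lam * (((eigMatrix ψ).transpose * eigMatrix ψ) *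
          Matrix.diagonal lam * (eigMatrix ψ).transpose)) := by
          simp only [Matrix.mul_assoc]
      _ = _ := by
          rw [eigMatrix_transpose_mul h.orthonormal, Matrix.one_mul]
          simp only [Matrix.mul_assoc]
  rw [this, Matrix.trace_mul_comm, Matrix.mul_assoc, eigMatrix_transpose_mul h.orthonormal,
    Matrix.mul_one, Matrix.diagonal_mul_diagonal, Matrix.trace_diagonal]
  simp [sq]

end Spectral

/-! ### Degree counts and common neighbours. -/

section Neighbours

variable {V U : Type*} [Fintype V] [Fintype U]

open Classical in
/-- The neighbours in `U` of a vertex of `V`. -/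
noncomputable def nbrU (G : SimpleGraph (V ⊕ U)) (v : V) : Finset U :=
  Finset.univ.filter fun u => G.Adj (Sum.inl v) (Sum.inr u)

open Classical in
/-- The neighbours in `V` of a vertex of `U`. -/
noncomputable def nbrV (G : SimpleGraph (V ⊕ U)) (u : U) : Finset V :=
  Finset.univ.filter fun v => G.Adj (Sum.inl v) (Sum.inr u)

variable {G : SimpleGraph (V ⊕ U)} {d k : ℕ}

omit [Fintype V] in
@[simp] theorem mem_nbrU {v : V} {u : U} : u ∈ nbrU G v ↔ G.Adj (Sum.inl v) (Sum.inr u) := by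
  simp [nbrU]

omit [Fintype U] in
@[simp] theorem mem_nbrV {v : V} {u : U} : v ∈ nbrV G u ↔ G.Adj (Sum.inl v) (Sum.inr u) := by
  simp [nbrV]

omit [Fintype V] [Fintype U] in
theorem IsBiregularC4Free.not_adj_inl (h : IsBiregularC4Free G d k) (v v' : V) :
    ¬ G.Adj (Sum.inl v) (Sum.inl v') := fun hv => by
  simpa using h.bipartite hv

omit [Fintype V] [Fintype U] in
theorem IsBiregularC4Free.not_adj_inr (h : IsBiregularC4Free G d k) (u u' : U) :
    ¬ G.Adj (Sum.inr u) (Sum.inr u') := fun hv => by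
  simpa using h.bipartite hv

omit [Fintype V] in
theorem IsBiregularC4Free.card_nbrU (h : IsBiregularC4Free G d k) (v : V) :
    (nbrU G v).card = d := by
  rw [← h.degree_left v]
  have : G.neighborSet (Sum.inl v) = Sum.inr '' (nbrU G v : Set U) := by
    ext x
    rcases x with x | x
    · simp [h.not_adj_inl]
    · simp
  rw [this, Set.ncard_image_of_injective _ Sum.inr_injective, Set.ncard_coe_finset]

omit [Fintype U] in
theorem IsBiregularC4Free.card_nbrV (h : IsBiregularC4Free G d k) (u : U) :
    (nbrV G u).card = k + 1 := by
  rw [← h.degree_right u]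
  have : G.neighborSet (Sum.inr u) = Sum.inl '' (nbrV G u : Set V) := by
    ext x
    rcases x with x | x
    · simp [G.adj_comm]
    · simp [h.not_adj_inr]
  rw [this, Set.ncard_image_of_injective _ Sum.inl_injective, Set.ncard_coe_finset]

omit [Fintype V] in
theorem IsBiregularC4Free.eq_of_common (h : IsBiregularC4Free G d k) {v v' : V} (hv : v ≠ v')
    {u u' : U} (h1 : u ∈ nbrU G v) (h2 : u ∈ nbrU G v') (h3 : u' ∈ nbrU G v)
    (h4 : u' ∈ nbrU G v') : u = u' := by
  have h5 : ∀ {w : U}, w ∈ nbrU G v → w ∈ nbrU G v' →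
      Sum.inr w ∈ G.commonNeighbors (Sum.inl v) (Sum.inl v') := fun hw hw' => by
    rw [SimpleGraph.mem_commonNeighbors]
    exact ⟨mem_nbrU.mp hw, mem_nbrU.mp hw'⟩
  exact Sum.inr_injective (h.c4_free _ _ (Sum.inl_injective.ne hv) (h5 h1 h2) (h5 h3 h4))

theorem IsBiregularC4Free.card_mul (h : IsBiregularC4Free G d k) :
    Fintype.card U * (k + 1) = Fintype.card V * d := by
  classical
  have := Finset.sum_card_bipartiteAbove_eq_sum_card_bipartiteBelow
    (s := (Finset.univ : Finset V)) (t := (Finset.univ : Finset U))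
    (r := fun v u => G.Adj (Sum.inl v) (Sum.inr u))
  have h1 : ∀ v : V, (Finset.univ.bipartiteAbove
      (fun v u => G.Adj (Sum.inl v) (Sum.inr u)) v).card = d := fun v => by
    rw [← h.card_nbrU v]; rfl
  have h2 : ∀ u : U, (Finset.univ.bipartiteBelow
      (fun v u => G.Adj (Sum.inl v) (Sum.inr u)) u).card = k + 1 := fun u => by
    rw [← h.card_nbrV u]; rfl
  simp only [h1, h2, Finset.sum_const, Finset.card_univ, smul_eq_mul] at this
  exact this.symm

end Neighbours

/-- Meant for off-diagonal entries of B Bᵀ: by C₄-freeness at most one term of the sum is nonzero.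
-/
theorem sq_sum_eq_sum_sq {ι : Type*} [Fintype ι] {f : ι → ℝ}
    (hf : ∀ i j, i ≠ j → f i * f j = 0) : (∑ i, f i) ^ 2 = ∑ i, f i ^ 2 := by
  rw [sq, Finset.sum_mul_sum]
  refine Finset.sum_congr rfl fun i _ => ?_
  rw [Finset.sum_eq_single i (fun j _ hj => hf i j hj.symm) (by simp), sq]

/-! ### The first two traces of L⁻. -/

section Trace

variable {V U : Type*} [Fintype V] [Fintype U] {G : SimpleGraph (V ⊕ U)} {d k : ℕ}
  {B : Matrix V U ℝ}

open Classical in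
omit [Fintype V] [Fintype U] in
theorem IsSignedAdjMatrix.sq_apply (hB : IsSignedAdjMatrix G B) (v : V) (u : U) :
    B v u ^ 2 = if G.Adj (Sum.inl v) (Sum.inr u) then 1 else 0 := by
  split_ifs with h
  · rcases (hB v u).1 h with h | h <;> simp [h]
  · simp [(hB v u).2 h]

omit [Fintype U] in
theorem IsSignedAdjMatrix.sum_sq_left (hB : IsSignedAdjMatrix G B)
    (hG : IsBiregularC4Free G d k) (u : U) : ∑ v, B v u ^ 2 = k + 1 := by
  classical
  simp_rw [hB.sq_apply, Finset.sum_boole]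
  exact_mod_cast hG.card_nbrV u

omit [Fintype V] in
theorem IsSignedAdjMatrix.sum_sq_right (hB : IsSignedAdjMatrix G B)
    (hG : IsBiregularC4Free G d k) (v : V) : ∑ u, B v u ^ 2 = d := by
  classical
  simp_rw [hB.sq_apply, Finset.sum_boole]
  exact_mod_cast hG.card_nbrU v

omit [Fintype V] in
theorem IsSignedAdjMatrix.sq_mul_transpose_apply (hB : IsSignedAdjMatrix G B)
    (hG : IsBiregularC4Free G d k) {v v' : V} (hv : v ≠ v') :
    (B * B.transpose) v v' ^ 2 = ∑ u, B v u ^ 2 * B v' u ^ 2 := by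
  rw [Matrix.mul_apply, sq_sum_eq_sum_sq]
  · simp [mul_pow]
  · intro u u' huu
    by_contra hne
    simp only [Matrix.transpose_apply, mul_eq_zero, not_or] at hne
    have hadj : ∀ {w : V} {x : U}, B w x ≠ 0 → x ∈ nbrU G w := fun {w x} h => by
      by_contra h'
      exact h ((hB w x).2 (by simpa using h'))
    exact huu (hG.eq_of_common hv (hadj hne.1.1) (hadj hne.1.2) (hadj hne.2.1) (hadj hne.2.2))

omit [Fintype V] in
theorem IsSignedAdjMatrix.mul_transpose_diag (hB : IsSignedAdjMatrix G B)
    (hG : IsBiregularC4Free G d k) (v : V) : (B * B.transpose) v v = d := by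
  rw [Matrix.mul_apply, ← hB.sum_sq_right hG v]
  simp [sq]

omit [Fintype U] in
theorem IsSignedAdjMatrix.lapMinus_diag (hB : IsSignedAdjMatrix G B)
    (hG : IsBiregularC4Free G d k) (u : U) : lapMinus d B u u = (k + 1) / d := by
  rw [lapMinus, Matrix.smul_apply, Matrix.mul_apply, ← hB.sum_sq_left hG u, smul_eq_mul,
    div_eq_inv_mul]
  simp [sq]

theorem IsSignedAdjMatrix.trace_lapMinus (hB : IsSignedAdjMatrix G B)
    (hG : IsBiregularC4Free G d k) (hd : 0 < d) :
    (lapMinus d B).trace = Fintype.card V := by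
  have h := hG.card_mul
  have h' : (Fintype.card U : ℝ) * (k + 1) = Fintype.card V * d := by exact_mod_cast h
  simp only [Matrix.trace, Matrix.diag, hB.lapMinus_diag hG, Finset.sum_const, Finset.card_univ,
    nsmul_eq_mul]
  rw [← mul_div_assoc, h']
  field_simp

theorem IsSignedAdjMatrix.trace_lapMinus_sq (hB : IsSignedAdjMatrix G B)
    (hG : IsBiregularC4Free G d k) (hd : 0 < d) :
    (lapMinus d B * lapMinus d B).trace = Fintype.card V * (1 + k / d) := by
  classical
  have h := hG.card_mul
  have h' : (Fintype.card U : ℝ) * (k + 1) = Fintype.card V * d := by exact_mod_cast h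
  -- Off the diagonal the signs disappear on squaring. On the diagonal the sum gives d whereas the
  -- entry squared is d², hence the correction d² - d.
  have hM : ∀ v v', (B * B.transpose) v v' * (B * B.transpose) v' v =
      ∑ u, B v u ^ 2 * B v' u ^ 2 + if v = v' then (d : ℝ) ^ 2 - d else 0 := by
    intro v v'
    have hsymm : (B * B.transpose) v' v = (B * B.transpose) v v' := by
      simp [Matrix.mul_apply, mul_comm]
    rw [hsymm, ← sq]
    split_ifs with hv
    · subst hv
      have : ∑ u, B v u ^ 2 * B v u ^ 2 = d := by
        rw [← hB.sum_sq_right hG v]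
        refine Finset.sum_congr rfl fun u _ => ?_
        rw [hB.sq_apply]; simp
      rw [this, hB.mul_transpose_diag hG]; ring
    · rw [hB.sq_mul_transpose_apply hG hv, add_zero]
  have h1 : (B * B.transpose * (B * B.transpose)).trace =
      Fintype.card V * ((d : ℝ) ^ 2 + d * k) := by
    simp only [Matrix.trace, Matrix.diag, Matrix.mul_apply (M := B * B.transpose), hM]
    simp only [Finset.sum_add_distrib, Finset.sum_ite_eq, Finset.mem_univ, if_true,
      Finset.sum_const, Finset.card_univ, nsmul_eq_mul]
    have h2 : ∑ v, ∑ v', ∑ u, B v u ^ 2 * B v' u ^ 2 = Fintype.card U * ((k : ℝ) + 1) ^ 2 := by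
      have : ∀ v, ∑ v', ∑ u, B v u ^ 2 * B v' u ^ 2 = ∑ u, B v u ^ 2 * ((k : ℝ) + 1) := by
        intro v
        rw [Finset.sum_comm]
        refine Finset.sum_congr rfl fun u _ => ?_
        rw [← Finset.mul_sum, hB.sum_sq_left hG]
      simp only [this]
      rw [Finset.sum_comm]
      simp only [← Finset.sum_mul, hB.sum_sq_left hG, Finset.sum_const, Finset.card_univ,
        nsmul_eq_mul]
      ring
    rw [h2]
    linear_combination ((k : ℝ) + 1) * h'
  have h3 : lapMinus d B * lapMinus d B =
      ((d : ℝ)⁻¹ * (d : ℝ)⁻¹) • (B.transpose * (B * B.transpose * B)) := by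
    simp only [lapMinus, Matrix.smul_mul, Matrix.mul_smul, smul_smul, Matrix.mul_assoc]
  rw [h3, Matrix.trace_smul, Matrix.trace_mul_comm, Matrix.mul_assoc, h1, smul_eq_mul]
  field_simp

end Trace

/-! ### Spectral bounds on the marginals p_u. -/

section SpectralBounds

variable {V U : Type*} [Fintype V] [Fintype U] [DecidableEq U] {G : SimpleGraph (V ⊕ U)}
  {d k : ℕ} {B : Matrix V U ℝ} {lam : Fin B.rank → ℝ} {ψ : Fin B.rank → EuclideanSpace ℝ U}

/-- This is the trace of (d⁻¹ B Bᵀ - 1)² over V: each of the |V| - rank B zero eigenvalues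
contributes (0 - 1)² = 1. -/
theorem IsPositiveEigensystem.sum_sq_sub_one (h : IsPositiveEigensystem d B lam ψ)
    (hB : IsSignedAdjMatrix G B) (hG : IsBiregularC4Free G d k) (hd : 0 < d) :
    ∑ i, (lam i - 1) ^ 2 + (Fintype.card V - B.rank : ℝ) = Fintype.card V * (k / d) := by
  have h1 := h.trace_lapMinus.symm.trans (hB.trace_lapMinus hG hd)
  have h2 := h.trace_lapMinus_sq.symm.trans (hB.trace_lapMinus_sq hG hd)
  have h3 : ∑ i, (lam i - 1) ^ 2 = ∑ i, lam i ^ 2 - 2 * ∑ i, lam i + B.rank := by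
    rw [Finset.mul_sum, ← Finset.sum_sub_distrib]
    have : (B.rank : ℝ) = ∑ _i : Fin B.rank, (1 : ℝ) := by simp
    conv_rhs => rw [this]
    rw [← Finset.sum_add_distrib]
    exact Finset.sum_congr rfl fun i _ => by ring
  rw [h3, h1, h2]; ring

theorem IsPositiveEigensystem.card_sub_rank_le (h : IsPositiveEigensystem d B lam ψ)
    (hB : IsSignedAdjMatrix G B) (hG : IsBiregularC4Free G d k) (hd : 0 < d) :
    (Fintype.card V - B.rank : ℝ) ≤ Fintype.card V * (k / d) := by
  rw [← h.sum_sq_sub_one hB hG hd]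
  linarith [Finset.sum_nonneg fun i (_ : i ∈ Finset.univ) => sq_nonneg (lam i - 1)]

theorem IsPositiveEigensystem.card_exceptional_le (h : IsPositiveEigensystem d B lam ψ)
    (hB : IsSignedAdjMatrix G B) (hG : IsBiregularC4Free G d k) (hd : 0 < d) {ε : ℝ}
    (hε : 0 < ε) :
    ((Finset.univ.filter fun i => ε < (lam i - 1) ^ 2).card : ℝ) ≤
      Fintype.card V * (k / (d * ε)) := by
  have h1 := h.sum_sq_sub_one hB hG hd
  have h2 : (B.rank : ℝ) ≤ Fintype.card V := by exact_mod_cast B.rank_le_card_height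
  have h3 : ((Finset.univ.filter fun i => ε < (lam i - 1) ^ 2).card : ℝ) * ε ≤
      ∑ i, (lam i - 1) ^ 2 := by
    rw [← nsmul_eq_mul]
    refine (Finset.card_nsmul_le_sum _ (fun i => (lam i - 1) ^ 2) _ fun i hi =>
      (Finset.mem_filter.mp hi).2.le).trans ?_
    exact Finset.sum_le_sum_of_subset_of_nonneg (Finset.filter_subset _ _)
      fun i _ _ => sq_nonneg _
  have h4 : (Fintype.card V : ℝ) * (k / (d * ε)) = Fintype.card V * (k / d) / ε := by
    field_simp
  rw [h4, le_div_iff₀ hε]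
  linarith

theorem IsPositiveEigensystem.projMatrix_diag_le (h : IsPositiveEigensystem d B lam ψ)
    (hB : IsSignedAdjMatrix G B) (hG : IsBiregularC4Free G d k) {ε : ℝ} (hε : ε ≤ 1 / 4)
    (u : U) :
    projMatrix (rowSpace B) u u ≤
      2 * ((k + 1) / d) + ∑ i with ε < (lam i - 1) ^ 2, ψ i u ^ 2 := by
  rw [h.projMatrix_apply, ← Finset.sum_filter_not_add_sum_filter _ (fun i => ε < (lam i - 1) ^ 2)]
  simp only [← sq]
  refine add_le_add_left ?_ _
  rw [← hB.lapMinus_diag hG u, h.lapMinus_diag, Finset.mul_sum]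
  refine le_trans (Finset.sum_le_sum fun i hi => ?_)
    (Finset.sum_le_sum_of_subset_of_nonneg (Finset.filter_subset _ _) fun i _ _ => ?_)
  · have hi' := not_lt.mp (Finset.mem_filter.mp hi).2
    -- Here ε ≤ 1/4 is used: (λ - 1)² ≤ 1/4 forces λ ≥ 1/2, so ψ(u)² ≤ 2 λ ψ(u)², and these terms
    -- sum to at most 2 L⁻_{uu}.
    have : 1 / 2 ≤ lam i := by nlinarith
    nlinarith [sq_nonneg (ψ i u)]
  · have := (h.pos i).le
    positivity

omit [DecidableEq U] in
theorem IsPositiveEigensystem.sum_exceptional_mass (h : IsPositiveEigensystem d B lam ψ) (ε : ℝ) :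
    ∑ u, ∑ i with ε < (lam i - 1) ^ 2, ψ i u ^ 2 =
      ((Finset.univ.filter fun i => ε < (lam i - 1) ^ 2).card : ℝ) := by
  rw [Finset.sum_comm, Finset.card_eq_sum_ones, Nat.cast_sum]
  refine Finset.sum_congr rfl fun i _ => ?_
  have := h.orthonormal.1 i
  rw [EuclideanSpace.norm_eq, Real.sqrt_eq_one] at this
  simpa using this

-- Bounds the expected number of structured vertices in the sample. The exceptional eigenvectors
-- have total mass N ≤ |V| k/(dε); each structured vertex carries more than δ of it, so there are at
-- most N/δ of them. The first term is the ordinary contribution 2(k+1)/d per vertex, the second is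
-- N itself.
open Classical in
theorem IsPositiveEigensystem.sum_structured_le (h : IsPositiveEigensystem d B lam ψ)
    (hB : IsSignedAdjMatrix G B) (hG : IsBiregularC4Free G d k) (hd : 0 < d) {ε δ : ℝ}
    (hε : 0 < ε) (hε' : ε ≤ 1 / 4) (hδ : 0 < δ) :
    ∑ u with u ∈ structuredSet lam ψ ε δ, projMatrix (rowSpace B) u u ≤
      Fintype.card V * (2 * (k + 1) * k / (ε * δ * (d : ℝ) ^ 2) + k / (ε * d)) := by
  set N : ℝ := ((Finset.univ.filter fun i => ε < (lam i - 1) ^ 2).card : ℝ)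
  have hN : N ≤ Fintype.card V * (k / (d * ε)) := h.card_exceptional_le hB hG hd hε
  have hmass : ∀ S : Finset U, ∑ u ∈ S, ∑ i with ε < (lam i - 1) ^ 2, ψ i u ^ 2 ≤ N :=
    fun S => by
      refine le_trans ?_ (h.sum_exceptional_mass ε).le
      exact Finset.sum_le_sum_of_subset_of_nonneg (Finset.subset_univ _)
        fun u _ _ => Finset.sum_nonneg fun i _ => sq_nonneg _
  set S : Finset U := Finset.univ.filter (· ∈ structuredSet lam ψ ε δ)
  have hS : (S.card : ℝ) * δ ≤ N := by
    rw [← nsmul_eq_mul]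
    exact (Finset.card_nsmul_le_sum _ _ _ fun u hu => (Finset.mem_filter.mp hu).2.le).trans
      (hmass S)
  have hd' : (0 : ℝ) < d := by exact_mod_cast hd
  calc ∑ u ∈ S, projMatrix (rowSpace B) u u
      ≤ ∑ u ∈ S, (2 * ((k + 1) / d) + ∑ i with ε < (lam i - 1) ^ 2, ψ i u ^ 2) :=
        Finset.sum_le_sum fun u _ => h.projMatrix_diag_le hB hG hε' u
    _ ≤ S.card * (2 * ((k + 1) / d)) + N := by
        rw [Finset.sum_add_distrib, Finset.sum_const, nsmul_eq_mul]
        exact add_le_add_right (hmass S) _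
    _ ≤ (Fintype.card V * (k / (d * ε)) / δ) * (2 * ((k + 1) / d)) +
          Fintype.card V * (k / (d * ε)) := by
        refine add_le_add (mul_le_mul_of_nonneg_right ?_ (by positivity)) hN
        rw [le_div_iff₀ hδ]
        exact hS.trans hN
    _ = _ := by field_simp

end SpectralBounds

/-! ### The number of vertices of V touched by a sample. -/

section Coverage

variable {V U : Type*} [Fintype V] [Fintype U] [DecidableEq U] {B : Matrix V U ℝ}

omit [Fintype V] [DecidableEq U] in
theorem starProjection_rowSpace_eq_zero {x : EuclideanSpace ℝ U} (hx : B.mulVec x = 0) :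
    (rowSpace B).starProjection x = 0 := by
  rw [Submodule.starProjection_apply_eq_zero_iff, Submodule.mem_orthogonal]
  intro y hy
  induction hy using Submodule.span_induction with
  | mem y hy =>
    obtain ⟨v, rfl⟩ := hy
    have := congrFun hx v
    rw [PiLp.inner_apply]
    simpa [Matrix.mulVec, dotProduct, mul_comm] using this
  | zero => simp
  | add y z _ _ hy hz => rw [inner_add_left, hy, hz, add_zero]
  | smul a y _ hy => rw [inner_smul_left, hy, mul_zero]

open Classical in
/-- Almost surely, a determinantal sample touches at least `rank B` rows of `B`. -/
theorem rank_le_card_covered {T : Finset U} (hT : detWeight (rowSpace B) T ≠ 0) :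
    B.rank ≤ (Finset.univ.filter fun v => ∃ u ∈ T, B v u ≠ 0).card := by
  set R : Finset V := Finset.univ.filter fun v => ∃ u ∈ T, B v u ≠ 0
  have hcard : T.card = B.rank := by
    by_contra h
    rw [← finrank_rowSpace] at h
    exact hT (if_neg h)
  have hdet : ((projMatrix (rowSpace B)).submatrix (Subtype.val : T → U)
      (Subtype.val : T → U)).det ≠ 0 := by
    rwa [detWeight, if_pos (hcard.trans (finrank_rowSpace B).symm)] at hT
  -- This block is injective: a kernel vector, extended by zero, is killed by B (rows outside R
  -- vanish on T), hence by P, hence by the invertible block of P on T. So rank B = |T| ≤ |R|.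
  let f := (B.submatrix (Subtype.val : R → V) (Subtype.val : T → U)).mulVecLin
  have hf : Function.Injective f := by
    rw [← LinearMap.ker_eq_bot, LinearMap.ker_eq_bot']
    intro x hx
    let y : EuclideanSpace ℝ U := WithLp.toLp 2 fun u => if h : u ∈ T then x ⟨u, h⟩ else 0
    have hsum : ∀ g : U → ℝ, ∑ u, g u * y u = ∑ u : T, g u * x u := by
      intro g
      rw [← Finset.sum_subset (Finset.subset_univ T) (fun u _ hu => by simp [y, hu]),
        ← Finset.sum_coe_sort T]
      exact Finset.sum_congr rfl fun u _ => by simp [y]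
    have hy : B.mulVec y = 0 := by
      ext v
      have h1 : B.mulVec y v = ∑ u : T, B v u * x u := hsum (B v)
      rw [h1]
      by_cases hv : v ∈ R
      · exact congrFun hx ⟨v, hv⟩
      · refine Finset.sum_eq_zero fun u _ => ?_
        have : B v u = 0 := by
          by_contra hne
          exact hv (Finset.mem_filter.mpr ⟨Finset.mem_univ _, u, u.2, hne⟩)
        rw [this, zero_mul]
    refine Matrix.eq_zero_of_mulVec_eq_zero hdet ?_
    ext u
    have h2 := congrFun (projMatrix_mulVec (rowSpace B) y) u
    rw [starProjection_rowSpace_eq_zero hy] at h2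
    have h3 : (projMatrix (rowSpace B)).mulVec y u =
      ∑ u' : T, projMatrix (rowSpace B) u u' * x u' := hsum _
    exact h3.symm.trans h2
  have := LinearMap.finrank_le_finrank_of_injective hf
  simpa [hcard] using this

end Coverage

/-! ### Probabilities over the pair (o, 𝒯). -/

section Prob

variable {V U : Type*} [Fintype V] [Nonempty V] [Fintype U] [DecidableEq U]

open Classical in
/-- The probability that `(o, 𝒯)` satisfies `E`, as a real number. -/
noncomputable def realProb (B : Matrix V U ℝ) (E : V → Finset U → Prop) : ℝ :=
  (∑ o, ∑ T, if E o T then detWeight (rowSpace B) T else 0) / Fintype.card V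

theorem prob_eq_ofReal (B : Matrix V U ℝ) (E : V → Finset U → Prop) :
    prob B E = ENNReal.ofReal (realProb B E) := by
  classical
  have hV : (0 : ℝ) < Fintype.card V := by exact_mod_cast Fintype.card_pos
  have h1 : ∀ o T, jointLaw B (o, T) =
      ENNReal.ofReal (detWeight (rowSpace B) T / Fintype.card V) := by
    intro o T
    rw [jointLaw, PMF.bind_apply, tsum_fintype, Finset.sum_eq_single o]
    · rw [PMF.map_apply, tsum_fintype, Finset.sum_eq_single T]
      · rw [if_pos rfl, PMF.uniformOfFintype_apply, detPMF, PMF.ofFintype_apply,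
          ENNReal.ofReal_div_of_pos hV, ENNReal.ofReal_natCast, mul_comm, div_eq_mul_inv]
      · intro T' _ hT'
        rw [if_neg]
        simpa using hT'.symm
      · simp
    · intro o' _ ho'
      rw [PMF.map_apply, tsum_fintype, Finset.sum_eq_zero, mul_zero]
      intro T' _
      rw [if_neg]
      simp [ho'.symm]
    · simp
  have h2 : ∀ o T, 0 ≤ (if E o T then detWeight (rowSpace B) T / Fintype.card V else 0) := by
    intro o T
    split_ifs
    · exact div_nonneg (detWeight_nonneg _ _) hV.le
    · exact le_rfl
  rw [prob, PMF.toOuterMeasure_apply_fintype, Fintype.sum_prod_type, realProb, Finset.sum_div,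
    ENNReal.ofReal_sum_of_nonneg (fun o _ => div_nonneg (Finset.sum_nonneg fun T _ => by
      split_ifs
      exacts [detWeight_nonneg _ _, le_rfl]) hV.le)]
  refine Finset.sum_congr rfl fun o _ => ?_
  rw [Finset.sum_div, ENNReal.ofReal_sum_of_nonneg (fun T _ => by
    split_ifs
    exacts [div_nonneg (detWeight_nonneg _ _) hV.le, by simp])]
  refine Finset.sum_congr rfl fun T _ => ?_
  by_cases h : E o T
  · simp [Set.indicator, h, h1]
  · simp [Set.indicator, h]

variable (B : Matrix V U ℝ)

omit [Nonempty V] in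
theorem realProb_mono {E F : V → Finset U → Prop}
    (h : ∀ o T, detWeight (rowSpace B) T ≠ 0 → E o T → F o T) :
    realProb B E ≤ realProb B F := by
  classical
  refine div_le_div_of_nonneg_right ?_ (Nat.cast_nonneg _)
  refine Finset.sum_le_sum fun o _ => Finset.sum_le_sum fun T _ => ?_
  have := detWeight_nonneg (rowSpace B) T
  by_cases hT : detWeight (rowSpace B) T = 0
  · simp [hT]
  · split_ifs with h1 h2 h2
    exacts [le_rfl, absurd (h o T hT h1) h2, this, le_rfl]

omit [Nonempty V] in
theorem realProb_or_le (E F : V → Finset U → Prop) :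
    realProb B (fun o T => E o T ∨ F o T) ≤ realProb B E + realProb B F := by
  classical
  unfold realProb
  rw [← add_div, ← Finset.sum_add_distrib]
  refine div_le_div_of_nonneg_right ?_ (Nat.cast_nonneg _)
  refine Finset.sum_le_sum fun o _ => ?_
  rw [← Finset.sum_add_distrib]
  refine Finset.sum_le_sum fun T _ => ?_
  have := detWeight_nonneg (rowSpace B) T
  split_ifs <;> first | tauto | linarith

omit [Nonempty V] in
theorem realProb_nonneg (E : V → Finset U → Prop) : 0 ≤ realProb B E := by
  classical
  refine div_nonneg (Finset.sum_nonneg fun o _ => Finset.sum_nonneg fun T _ => ?_)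
    (Nat.cast_nonneg _)
  split_ifs
  exacts [detWeight_nonneg _ _, le_rfl]

theorem realProb_add_not (E : V → Finset U → Prop) :
    realProb B E + realProb B (fun o T => ¬ E o T) = 1 := by
  classical
  have hV : (0 : ℝ) < Fintype.card V := by exact_mod_cast Fintype.card_pos
  unfold realProb
  rw [← add_div, ← Finset.sum_add_distrib, div_eq_one_iff_eq hV.ne']
  have : ∀ o : V, ((∑ T, if E o T then detWeight (rowSpace B) T else 0) +
      ∑ T, if ¬ E o T then detWeight (rowSpace B) T else 0) = 1 := by
    intro o
    rw [← sum_detWeight (rowSpace B), ← Finset.sum_add_distrib]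
    refine Finset.sum_congr rfl fun T _ => ?_
    split_ifs <;> simp
  calc _ = ∑ _o : V, (1 : ℝ) := Finset.sum_congr rfl fun o _ => by convert this o
    _ = _ := by simp

theorem realProb_le_of_forall {E : V → Finset U → Prop} {c : ℝ}
    (h : ∀ o, (open Classical in ∑ T, if E o T then detWeight (rowSpace B) T else 0) ≤ c) :
    realProb B E ≤ c := by
  have hV : (0 : ℝ) < Fintype.card V := by exact_mod_cast Fintype.card_pos
  unfold realProb
  rw [div_le_iff₀ hV]
  refine (Finset.sum_le_sum fun o _ => h o).trans ?_
  simp [mul_comm]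

/-- Fix T in the support and average over o: at most |V| - rank B ≤ |V| k/d vertices are untouched.
-/
theorem realProb_not_mem_inducedVerts_le {G : SimpleGraph (V ⊕ U)} {d k : ℕ} {B : Matrix V U ℝ}
    {lam : Fin B.rank → ℝ} {ψ : Fin B.rank → EuclideanSpace ℝ U}
    (h : IsPositiveEigensystem d B lam ψ) (hB : IsSignedAdjMatrix G B)
    (hG : IsBiregularC4Free G d k) (hd : 0 < d) :
    realProb B (fun o T => Sum.inl o ∉ inducedVerts G T) ≤ k / d := by
  classical
  have hV : (0 : ℝ) < Fintype.card V := by exact_mod_cast Fintype.card_pos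
  unfold realProb
  rw [div_le_iff₀ hV, mul_comm (_ / _), Finset.sum_comm]
  have key : ∀ T : Finset U, (∑ o : V, if Sum.inl o ∉ inducedVerts G T then
      detWeight (rowSpace B) T else 0) ≤
      detWeight (rowSpace B) T * (Fintype.card V * (k / d)) := by
    intro T
    rw [← Finset.sum_filter, Finset.sum_const, nsmul_eq_mul, mul_comm]
    by_cases hT : detWeight (rowSpace B) T = 0
    · simp [hT]
    refine mul_le_mul_of_nonneg_left ?_ (detWeight_nonneg _ _)
    refine le_trans ?_ (h.card_sub_rank_le hB hG hd)
    have h1 := rank_le_card_covered hT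
    have h2 : (Finset.univ.filter fun v => ∃ u ∈ T, B v u ≠ 0) ⊆
        Finset.univ.filter fun v => Sum.inl v ∈ inducedVerts G T := by
      intro v hv
      obtain ⟨u, hu, hne⟩ := (Finset.mem_filter.mp hv).2
      refine Finset.mem_filter.mpr ⟨Finset.mem_univ _, u, hu, Or.inr (SimpleGraph.Adj.symm ?_)⟩
      by_contra hadj
      exact hne ((hB v u).2 hadj)
    have h3 := Finset.card_filter_add_card_filter_not (s := (Finset.univ : Finset V))
      (fun v => Sum.inl v ∈ inducedVerts G T)
    have h4 := h1.trans (Finset.card_le_card h2)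
    rw [Finset.card_univ] at h3
    have h3' : ((Finset.univ.filter fun v => Sum.inl v ∈ inducedVerts G T).card : ℝ) +
      (Finset.univ.filter fun v => Sum.inl v ∉ inducedVerts G T).card = Fintype.card V := by
      exact_mod_cast h3
    have h4' : (B.rank : ℝ) ≤
      (Finset.univ.filter fun v => Sum.inl v ∈ inducedVerts G T).card := by exact_mod_cast h4
    linarith
  refine (Finset.sum_le_sum fun T _ => (le_of_eq (Finset.sum_congr rfl fun o _ => by
    congr)).trans (key T)).trans ?_
  rw [← Finset.sum_mul, sum_detWeight, one_mul]

end Prob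

/-! ### Tree criterion; balls and levels. -/

/-- A graph with a level function such that every vertex other than the root has exactly one
neighbour of smaller level, and adjacent vertices have distinct levels, is a tree. -/
theorem isTree_of_level {X : Type*} {H : SimpleGraph X} (l : X → ℕ) (o : X)
    (hparent : ∀ x, x ≠ o → ∃ y, H.Adj x y ∧ l y < l x)
    (hne : ∀ x y, H.Adj x y → l x ≠ l y)
    (huniq : ∀ x y z, H.Adj x y → H.Adj x z → l y < l x → l z < l x → y = z) : H.IsTree := by
  classical
  have hreach : ∀ n x, l x = n → H.Reachable x o := by
    intro n
    induction n using Nat.strong_induction_on with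
    | _ n ih =>
      intro x hx
      by_cases hxo : x = o
      · rw [hxo]
      · obtain ⟨y, hxy, hlt⟩ := hparent x hxo
        exact hxy.reachable.trans (ih (l y) (hx ▸ hlt) y rfl)
  have hpre : H.Preconnected := fun x y => (hreach _ x rfl).trans (hreach _ y rfl).symm
  refine ⟨@SimpleGraph.Connected.mk _ _ hpre ⟨o⟩, ?_⟩
  intro v c hc
  -- At a vertex of maximal level on a cycle both cycle neighbours have smaller level, so they
  -- coincide, which is impossible.
  obtain ⟨x, hx, hmax⟩ := c.support.toFinset.exists_max_image l ⟨v, by simp⟩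
  rw [List.mem_toFinset] at hx
  have hc' := hc.rotate hx
  have hle : ∀ y ∈ (c.rotate x hx).support, l y ≤ l x := fun y hy =>
    hmax y (List.mem_toFinset.mpr (by simpa using hy))
  have h1 := (c.rotate x hx).adj_snd hc'.not_nil
  have h2 := ((c.rotate x hx).adj_penultimate hc'.not_nil).symm
  refine hc'.snd_ne_penultimate (huniq x _ _ h1 h2 ?_ ?_)
  · exact lt_of_le_of_ne (hle _ (SimpleGraph.Walk.getVert_mem_support _ _)) (hne _ _ h1).symm
  · exact lt_of_le_of_ne (hle _ (SimpleGraph.Walk.getVert_mem_support _ _)) (hne _ _ h2).symm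

section Ball

variable {V U : Type*} {G : SimpleGraph (V ⊕ U)} {T : Finset U} {o : V}

theorem mem_inducedVerts_of_mem_sampleBall {n : ℕ} {x : V ⊕ U} (h : x ∈ sampleBall G T o n) :
    x ∈ inducedVerts G T := h.2.1

theorem sampleBall_mono {m n : ℕ} (h : m ≤ n) : sampleBall G T o m ⊆ sampleBall G T o n :=
  fun _ ⟨ho, hx, hle⟩ => ⟨ho, hx, hle.trans (by exact_mod_cast h)⟩

theorem mem_sampleBall_zero {x : V ⊕ U} (h : x ∈ sampleBall G T o 0) : x = Sum.inl o := by
  obtain ⟨ho, hx, hle⟩ := h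
  have h0 := SimpleGraph.edist_eq_zero_iff.mp (nonpos_iff_eq_zero.mp hle)
  exact (congrArg Subtype.val h0).symm

theorem root_mem_sampleBall (ho : Sum.inl o ∈ inducedVerts G T) (n : ℕ) :
    Sum.inl o ∈ sampleBall G T o n := ⟨ho, ho, by simp⟩

theorem mem_sampleBall_succ_of_adj {n : ℕ} {x y : V ⊕ U} (hy : y ∈ sampleBall G T o n)
    (hxy : G.Adj y x) (hx : x ∈ inducedVerts G T) : x ∈ sampleBall G T o (n + 1) := by
  obtain ⟨ho, hy', hle⟩ := hy
  refine ⟨ho, hx, (SimpleGraph.edist_triangle (v := ⟨y, hy'⟩)).trans ?_⟩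
  have h1 : (G.induce (inducedVerts G T)).Adj ⟨y, hy'⟩ ⟨x, hx⟩ := hxy
  rw [SimpleGraph.edist_eq_one_iff_adj.mpr h1]
  push_cast
  gcongr

theorem mem_sampleBall_succ {n : ℕ} {x : V ⊕ U} (h : x ∈ sampleBall G T o (n + 1)) :
    x ∈ sampleBall G T o n ∨ ∃ y ∈ sampleBall G T o n, G.Adj y x := by
  obtain ⟨ho, hx, hle⟩ := h
  have hne : (G.induce (inducedVerts G T)).edist ⟨Sum.inl o, ho⟩ ⟨x, hx⟩ ≠ ⊤ :=
    ne_top_of_le_ne_top (ENat.natCast_ne_top _) hle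
  obtain ⟨p, hp⟩ := SimpleGraph.exists_walk_of_edist_ne_top hne
  rw [← hp] at hle
  have hlen : p.length ≤ n + 1 := by exact_mod_cast hle
  by_cases hnil : p.Nil
  · left
    refine ⟨ho, hx, ?_⟩
    rw [← hp, SimpleGraph.Walk.length_eq_zero_iff.mpr hnil]
    simp
  · right
    refine ⟨p.penultimate, ⟨ho, p.penultimate.2, ?_⟩, p.adj_penultimate hnil⟩
    refine (SimpleGraph.edist_le p.dropLast).trans ?_
    have := p.length_dropLast_add_one hnil
    exact_mod_cast (by omega : p.dropLast.length ≤ n)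

/-- The distance from `o` in `G[T]`. -/
noncomputable def ballLevel (G : SimpleGraph (V ⊕ U)) (T : Finset U) (o : V) (x : V ⊕ U) : ℕ :=
  sInf {n | x ∈ sampleBall G T o n}

theorem ballLevel_le {n : ℕ} {x : V ⊕ U} (h : x ∈ sampleBall G T o n) :
    ballLevel G T o x ≤ n := Nat.sInf_le h

/-- Membership in some ball is needed: `ballLevel` takes the default value 0 at vertices that are
never reached. -/
theorem mem_sampleBall_ballLevel {n : ℕ} {x : V ⊕ U} (h : x ∈ sampleBall G T o n) :
    x ∈ sampleBall G T o (ballLevel G T o x) :=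
  Nat.sInf_mem (s := {n | x ∈ sampleBall G T o n}) ⟨n, h⟩

theorem exists_adj_ballLevel {n m : ℕ} {x : V ⊕ U} (h : x ∈ sampleBall G T o n)
    (hm : ballLevel G T o x = m + 1) :
    ∃ y ∈ sampleBall G T o m, G.Adj y x ∧ ballLevel G T o y = m := by
  have h1 := mem_sampleBall_ballLevel h
  rw [hm] at h1
  rcases mem_sampleBall_succ h1 with h2 | ⟨y, hy, hyx⟩
  · have := ballLevel_le h2
    omega
  · refine ⟨y, hy, hyx, le_antisymm (ballLevel_le hy) ?_⟩
    have := ballLevel_le (mem_sampleBall_succ_of_adj (mem_sampleBall_ballLevel hy) hyx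
      (mem_inducedVerts_of_mem_sampleBall h))
    omega

/-- Bipartiteness makes the parity of the level determine the side, which rules out edges inside a
level. -/
theorem even_ballLevel_iff {d k : ℕ} (hG : IsBiregularC4Free G d k) :
    ∀ (m : ℕ) {n : ℕ} {x : V ⊕ U}, x ∈ sampleBall G T o n → ballLevel G T o x = m →
      (Even m ↔ x.isLeft) := by
  intro m
  induction m with
  | zero =>
    intro n x hx hm
    have h1 := mem_sampleBall_ballLevel hx
    rw [hm] at h1
    simp [mem_sampleBall_zero h1]
  | succ m ih =>
    intro n x hx hm
    obtain ⟨y, hy, hyx, hym⟩ := exists_adj_ballLevel hx hm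
    have h1 := ih hy hym
    have h2 := hG.bipartite hyx
    rw [Nat.even_add_one, h1]
    rcases x with x | x <;> rcases y with y | y <;> simp_all

theorem ballLevel_ne_of_adj {d k n n' : ℕ} (hG : IsBiregularC4Free G d k) {x y : V ⊕ U}
    (hx : x ∈ sampleBall G T o n) (hy : y ∈ sampleBall G T o n') (hxy : G.Adj x y) :
    ballLevel G T o x ≠ ballLevel G T o y := by
  intro h
  have h1 := even_ballLevel_iff hG _ hx h
  have h2 := even_ballLevel_iff hG _ hy rfl
  have h3 := hG.bipartite hxy
  rw [h1] at h2
  rcases x with x | x <;> rcases y with y | y <;> simp_all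

theorem mem_of_inr_mem_inducedVerts {d k : ℕ} (hG : IsBiregularC4Free G d k) {u : U}
    (h : Sum.inr u ∈ inducedVerts G T) : u ∈ T := by
  obtain ⟨u', hu', h | h⟩ := h
  · rwa [Sum.inr_injective h]
  · exact absurd (hG.bipartite h) (by simp)

end Ball

/-! ### Exploration sets and collisions. -/

section Grown

variable {V U : Type*} [Fintype V] [Fintype U] [DecidableEq U]

open Classical in
/-- The vertices of `W` together with the neighbours of the vertices of `S`. -/
noncomputable def reach (G : SimpleGraph (V ⊕ U)) (W : Finset V) (S : Finset U) : Finset V :=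
  W ∪ S.biUnion (nbrV G)

/-- The finite subsets of `good` which can be built up from `W` one vertex at a time, each new
vertex having a neighbour in `W` or a common neighbour with an older one. -/
inductive Grown (G : SimpleGraph (V ⊕ U)) (good : Set U) (W : Finset V) : Finset U → Prop
  | empty : Grown G good W ∅
  | insert {S : Finset U} {v : V} {u : U} : Grown G good W S → v ∈ reach G W S → u ∈ nbrU G v →
      u ∈ good → u ∉ S → Grown G good W (insert u S)

variable {G : SimpleGraph (V ⊕ U)} {good : Set U} {W : Finset V} {d k : ℕ}

omit [DecidableEq U] in
theorem mem_reach {S : Finset U} {v : V} :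
    v ∈ reach G W S ↔ v ∈ W ∨ ∃ u ∈ S, u ∈ nbrU G v := by
  simp [reach]

omit [DecidableEq U] in
theorem reach_mono {S S' : Finset U} (h : S ⊆ S') : reach G W S ⊆ reach G W S' := fun v hv => by
  rw [mem_reach] at hv ⊢
  exact hv.imp_right fun ⟨u, hu, huv⟩ => ⟨u, h hu, huv⟩

omit [Fintype U] [DecidableEq U] in
theorem card_reach_le (hG : IsBiregularC4Free G d k) (S : Finset U) :
    (reach G W S).card ≤ W.card + (k + 1) * S.card := by
  classical
  refine (Finset.card_union_le _ _).trans (Nat.add_le_add_left ?_ _)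
  refine (Finset.card_biUnion_le_card_mul _ _ (k + 1) fun u _ => (hG.card_nbrV u).le).trans ?_
  rw [mul_comm]

theorem Grown.subset_good {S : Finset U} (h : Grown G good W S) : ∀ u ∈ S, u ∈ good := by
  induction h with
  | empty => simp
  | insert _ _ _ hu _ ih =>
    intro w hw
    rcases Finset.mem_insert.mp hw with rfl | hw
    exacts [hu, ih w hw]

theorem Grown.insert' {S : Finset U} {v : V} {u : U} (h : Grown G good W S)
    (hv : v ∈ reach G W S) (hu : u ∈ nbrU G v) (hg : u ∈ good) :
    Grown G good W (Insert.insert u S) := by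
  by_cases huS : u ∈ S
  · rwa [Finset.insert_eq_of_mem huS]
  · exact h.insert hv hu hg huS

theorem Grown.union {S S' : Finset U} (h : Grown G good W S) (h' : Grown G good W S') :
    Grown G good W (S ∪ S') := by
  induction h' with
  | empty => simpa
  | insert _ hv hu hg _ ih =>
    rw [Finset.union_insert]
    exact ih.insert' (reach_mono Finset.subset_union_right hv) hu hg

open Classical in
/-- The grown sets of size `m`. -/
noncomputable def grownFamily (G : SimpleGraph (V ⊕ U)) (good : Set U) (W : Finset V) (m : ℕ) :
    Finset (Finset U) :=
  Finset.univ.filter fun S => Grown G good W S ∧ S.card = m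

theorem mem_grownFamily {m : ℕ} {S : Finset U} :
    S ∈ grownFamily G good W m ↔ Grown G good W S ∧ S.card = m := by
  simp [grownFamily]

/-- Each added vertex is one of the d neighbours of one of at most A reached vertices. -/
theorem card_grownFamily_le (hG : IsBiregularC4Free G d k) {A : ℕ} :
    ∀ {m : ℕ}, W.card + (k + 1) * m ≤ A → (grownFamily G good W m).card ≤ (d * A) ^ m := by
  classical
  intro m
  induction m with
  | zero =>
    intro _
    rw [pow_zero, Finset.card_le_one]
    intro S hS S' hS'
    rw [Finset.card_eq_zero.mp (mem_grownFamily.mp hS).2,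
      Finset.card_eq_zero.mp (mem_grownFamily.mp hS').2]
  | succ m ih =>
    intro hA
    have hA' : W.card + (k + 1) * m ≤ A :=
      le_trans (Nat.add_le_add_left (Nat.mul_le_mul_left _ (Nat.le_succ m)) _) hA
    have hsub : grownFamily G good W (m + 1) ⊆ (grownFamily G good W m).biUnion fun S =>
        ((reach G W S).biUnion (nbrU G)).image fun u => insert u S := by
      intro S' hS'
      obtain ⟨hgr, hcard⟩ := mem_grownFamily.mp hS'
      cases hgr with
      | empty => simp at hcard
      | @insert S v u hS hv hu hg huS =>
        rw [Finset.card_insert_of_notMem huS] at hcard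
        simp only [Finset.mem_biUnion, Finset.mem_image]
        exact ⟨S, mem_grownFamily.mpr ⟨hS, by omega⟩, u, ⟨v, hv, hu⟩, rfl⟩
    refine (Finset.card_le_card hsub).trans ?_
    refine (Finset.card_biUnion_le_card_mul _ _ (d * A) fun S hS => ?_).trans ?_
    · refine Finset.card_image_le.trans ?_
      refine (Finset.card_biUnion_le_card_mul _ _ d fun v _ => (hG.card_nbrU v).le).trans ?_
      rw [mul_comm]
      refine Nat.mul_le_mul_left _ ((card_reach_le hG S).trans ?_)
      rwa [(mem_grownFamily.mp hS).2]
    · rw [pow_succ]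
      exact Nat.mul_le_mul_right _ (ih hA')

/-- A vertex of a ball all of whose vertices in `U` are good is reached by a small grown set. -/
theorem exists_grown_of_mem_sampleBall (hG : IsBiregularC4Free G d k) {T : Finset U} {o : V} :
    ∀ {n : ℕ}, (∀ u, Sum.inr u ∈ sampleBall G T o n → u ∈ good) →
      ∀ {x : V ⊕ U}, x ∈ sampleBall G T o n → ∃ S, Grown G good {o} S ∧ S ⊆ T ∧ S.card ≤ n ∧
        (∀ u ∈ S, Sum.inr u ∈ sampleBall G T o n) ∧
        x ∈ (Sum.inl '' (reach G {o} S : Set V) ∪ Sum.inr '' (S : Set U)) := by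
  intro n
  induction n with
  | zero =>
    intro _ x hx
    exact ⟨∅, .empty, by simp, by simp, by simp, by
      rw [mem_sampleBall_zero hx]; simp [mem_reach]⟩
  | succ n ih =>
    intro hgood x hx
    have hmono := sampleBall_mono (G := G) (T := T) (o := o) (Nat.le_succ n)
    have hgood' : ∀ u, Sum.inr u ∈ sampleBall G T o n → u ∈ good := fun u hu =>
      hgood u (hmono hu)
    rcases mem_sampleBall_succ hx with hx' | ⟨y, hy, hyx⟩
    · obtain ⟨S, h1, h2, h3, h4, h5⟩ := ih hgood' hx'
      exact ⟨S, h1, h2, by omega, fun u hu => hmono (h4 u hu), h5⟩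
    · obtain ⟨S, h1, h2, h3, h4, h5⟩ := ih hgood' hy
      rcases y with v | u
      · have hv : v ∈ reach G {o} S := by simpa using h5
        rcases x with v' | u
        · exact absurd hyx (hG.not_adj_inl _ _)
        · have huT := mem_of_inr_mem_inducedVerts hG (mem_inducedVerts_of_mem_sampleBall hx)
          refine ⟨insert u S, h1.insert' hv (mem_nbrU.mpr hyx) (hgood u hx),
            Finset.insert_subset huT h2, (Finset.card_insert_le _ _).trans (by omega), ?_, ?_⟩
          · intro w hw
            rcases Finset.mem_insert.mp hw with rfl | hw
            exacts [hx, hmono (h4 w hw)]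
          · simp
      · have hu : u ∈ S := by simpa using h5
        rcases x with v | u'
        · refine ⟨S, h1, h2, by omega, fun w hw => hmono (h4 w hw), ?_⟩
          left
          exact ⟨v, mem_reach.mpr (Or.inr ⟨u, hu, mem_nbrU.mpr hyx.symm⟩), rfl⟩
        · exact absurd hyx (hG.not_adj_inr _ _)

/-- A path from o read backwards: growth starts at the far end and stops at o. This orientation
allows a sum over bad vertices instead of over roots. -/
theorem Grown.exists_root_mem_reach (hG : IsBiregularC4Free G d k) {T : Finset U} {o : V} :
    ∀ {n : ℕ}, (∀ u, Sum.inr u ∈ sampleBall G T o n → u ∈ good) →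
      ∀ {x : V ⊕ U}, x ∈ sampleBall G T o n → ∀ {S : Finset U}, Grown G good W S → S ⊆ T →
        x ∈ (Sum.inl '' (reach G W S : Set V) ∪ Sum.inr '' (S : Set U)) →
        ∃ S', Grown G good W S' ∧ S' ⊆ T ∧ S'.card ≤ S.card + n ∧ o ∈ reach G W S' := by
  intro n
  induction n with
  | zero =>
    intro _ x hx S h1 h2 h3
    rw [mem_sampleBall_zero hx] at h3
    exact ⟨S, h1, h2, by simp, by simpa using h3⟩
  | succ n ih =>
    intro hgood x hx S h1 h2 h3
    have hgood' : ∀ u, Sum.inr u ∈ sampleBall G T o n → u ∈ good := fun u hu =>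
      hgood u (sampleBall_mono (Nat.le_succ n) hu)
    rcases mem_sampleBall_succ hx with hx' | ⟨y, hy, hyx⟩
    · obtain ⟨S', h4, h5, h6, h7⟩ := ih hgood' hx' h1 h2 h3
      exact ⟨S', h4, h5, by omega, h7⟩
    · rcases y with v | u
      · rcases x with v' | u
        · exact absurd hyx (hG.not_adj_inl _ _)
        · have hu : u ∈ S := by simpa using h3
          obtain ⟨S', h4, h5, h6, h7⟩ := ih hgood' hy h1 h2
            (Or.inl ⟨v, mem_reach.mpr (Or.inr ⟨u, hu, mem_nbrU.mpr hyx⟩), rfl⟩)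
          exact ⟨S', h4, h5, by omega, h7⟩
      · rcases x with v | u'
        · have hv : v ∈ reach G W S := by simpa using h3
          have huT := mem_of_inr_mem_inducedVerts hG (mem_inducedVerts_of_mem_sampleBall hy)
          obtain ⟨S', h4, h5, h6, h7⟩ := ih hgood' hy
            (h1.insert' hv (mem_nbrU.mpr hyx.symm) (hgood' u hy))
            (Finset.insert_subset huT h2) (Or.inr ⟨u, by simp, rfl⟩)
          have := Finset.card_insert_le u S
          exact ⟨S', h4, h5, by omega, h7⟩
        · exact absurd hyx (hG.not_adj_inr _ _)

/-- If a ball contains a vertex of `U` which is not good, then its centre is reached by a small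
grown set around such a vertex. -/
theorem exists_grown_of_not_good (hG : IsBiregularC4Free G d k) {T : Finset U} {o : V} {r : ℕ}
    {u : U} (hu : Sum.inr u ∈ sampleBall G T o r) (hbad : u ∉ good) :
    ∃ u ∈ T, u ∉ good ∧ ∃ S, Grown G good (nbrV G u) S ∧ S ⊆ T ∧ S.card ≤ r ∧
      o ∈ reach G (nbrV G u) S := by
  classical
  -- Take a bad vertex at the least possible radius, which is positive since radius 0 leaves only o.
  -- All U-vertices of smaller balls are good, so the way back to o is good.
  have hex : ∃ n, ∃ u, Sum.inr u ∈ sampleBall G T o n ∧ u ∉ good := ⟨r, u, hu, hbad⟩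
  obtain ⟨u₀, hu₀, hbad₀⟩ := Nat.find_spec hex
  have hmin := fun n (hn : n < Nat.find hex) => Nat.find_min hex hn
  have hle : Nat.find hex ≤ r := Nat.find_min' hex ⟨u, hu, hbad⟩
  generalize Nat.find hex = N at *
  rcases N with _ | n
  · exact absurd (mem_sampleBall_zero hu₀) (by simp)
  have hgood : ∀ u, Sum.inr u ∈ sampleBall G T o n → u ∈ good := fun w hw => by
    by_contra hwb
    exact hmin n (Nat.lt_succ_self n) ⟨w, hw, hwb⟩
  refine ⟨u₀, mem_of_inr_mem_inducedVerts hG (mem_inducedVerts_of_mem_sampleBall hu₀), hbad₀, ?_⟩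
  rcases mem_sampleBall_succ hu₀ with h | ⟨y, hy, hyu⟩
  · exact absurd (hgood _ h) hbad₀
  rcases y with v | w
  · obtain ⟨S, h1, h2, h3, h4⟩ := Grown.exists_root_mem_reach hG hgood hy
      (Grown.empty (W := nbrV G u₀)) (Finset.empty_subset T)
      (Or.inl ⟨v, mem_reach.mpr (Or.inl (mem_nbrV.mpr hyu)), rfl⟩)
    refine ⟨S, h1, h2, ?_, h4⟩
    rw [Finset.card_empty] at h3
    omega
  · exact absurd hyu (hG.not_adj_inr _ _)

/-- There is a grown set `S ⊆ T` of size at most `m` and a further good vertex of `T` which is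
adjacent to two of the vertices reached by `S`. -/
def HasCollision (G : SimpleGraph (V ⊕ U)) (good : Set U) (o : V) (T : Finset U) (m : ℕ) : Prop :=
  ∃ S, Grown G good {o} S ∧ S ⊆ T ∧ S.card ≤ m ∧ ∃ v ∈ reach G {o} S, ∃ w ∈ reach G {o} S,
    v ≠ w ∧ ∃ u ∈ T, u ∈ good ∧ u ∉ S ∧ u ∈ nbrU G v ∧ u ∈ nbrU G w

/-- If x ∈ V has parents u₁, u₂, explore up to u₁, which reaches x; then u₂ joins x to its own
parent. If x ∈ U, its two parents are reached without it, and x is the colliding vertex. Two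
explorations of depth below r account for the size 2r. -/
theorem hasCollision_of_two_parents (hG : IsBiregularC4Free G d k) {T : Finset U} {o : V} {r : ℕ}
    (hgood : ∀ u, Sum.inr u ∈ sampleBall G T o r → u ∈ good) {x y z : V ⊕ U}
    (hx : x ∈ sampleBall G T o r) (hy : y ∈ sampleBall G T o r) (hz : z ∈ sampleBall G T o r)
    (hxy : G.Adj x y) (hxz : G.Adj x z) (hly : ballLevel G T o y < ballLevel G T o x)
    (hlz : ballLevel G T o z < ballLevel G T o x) (hyz : y ≠ z) :
    HasCollision G good o T (2 * r) := by
  have hxr := ballLevel_le hx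
  have hgood' : ∀ {n}, n ≤ r → ∀ u, Sum.inr u ∈ sampleBall G T o n → u ∈ good :=
    fun hn u hu => hgood u (sampleBall_mono hn hu)
  have hadj_level : ∀ {y}, y ∈ sampleBall G T o r → G.Adj x y →
      ballLevel G T o y < ballLevel G T o x → ballLevel G T o x = ballLevel G T o y + 1 := by
    intro y hy hxy hly
    have := ballLevel_le (mem_sampleBall_succ_of_adj (mem_sampleBall_ballLevel hy) hxy.symm
      (mem_inducedVerts_of_mem_sampleBall hx))
    omega
  have hy1 := hadj_level hy hxy hly
  have hz1 := hadj_level hz hxz hlz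
  have hy2 := mem_sampleBall_ballLevel hy
  have hz2 := mem_sampleBall_ballLevel hz
  rcases x with v | u
  · rcases y with y | u₁
    · exact absurd hxy (hG.not_adj_inl _ _)
    rcases z with z | u₂
    · exact absurd hxz (hG.not_adj_inl _ _)
    have hT1 := mem_of_inr_mem_inducedVerts hG (mem_inducedVerts_of_mem_sampleBall hy)
    have hT2 := mem_of_inr_mem_inducedVerts hG (mem_inducedVerts_of_mem_sampleBall hz)
    have hpos : ballLevel G T o (Sum.inr u₁) ≠ 0 := fun h0 => by
      rw [h0] at hy2
      exact absurd (mem_sampleBall_zero hy2) (by simp)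
    obtain ⟨m, hm⟩ := Nat.exists_eq_succ_of_ne_zero hpos
    obtain ⟨p₁, hp₁, hpu₁, -⟩ := exists_adj_ballLevel hy hm
    obtain ⟨p₂, hp₂, hpu₂, hpl₂⟩ := exists_adj_ballLevel (m := m) hz (by omega)
    have hmr : m ≤ r := by omega
    obtain ⟨S₁, a1, a2, a3, a4, a5⟩ := exists_grown_of_mem_sampleBall hG (hgood' hmr) hp₁
    obtain ⟨S₂, b1, b2, b3, b4, b5⟩ := exists_grown_of_mem_sampleBall hG (hgood' hmr) hp₂
    rcases p₁ with w₁ | p₁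
    swap
    · exact absurd hpu₁ (hG.not_adj_inr _ _)
    rcases p₂ with w₂ | p₂
    swap
    · exact absurd hpu₂ (hG.not_adj_inr _ _)
    have hw₁ : w₁ ∈ reach G {o} S₁ := by simpa using a5
    have hw₂ : w₂ ∈ reach G {o} S₂ := by simpa using b5
    -- The vertices of S₁ and S₂ lie in the ball of radius m, while u₂ has level m + 1.
    have hu₂ : u₂ ∉ insert u₁ (S₁ ∪ S₂) := by
      intro hmem
      rcases Finset.mem_insert.mp hmem with h | h
      · exact hyz (by rw [h])
      · have : Sum.inr u₂ ∈ sampleBall G T o m :=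
          (Finset.mem_union.mp h).elim (a4 u₂) (b4 u₂)
        have := ballLevel_le this
        omega
    refine ⟨insert u₁ (S₁ ∪ S₂), (a1.union b1).insert'
      (reach_mono Finset.subset_union_left hw₁) (mem_nbrU.mpr hpu₁) (hgood _ hy),
      Finset.insert_subset hT1 (Finset.union_subset a2 b2), ?_, v, ?_, w₂, ?_, ?_, u₂, hT2,
      hgood _ hz, hu₂, mem_nbrU.mpr hxz, mem_nbrU.mpr hpu₂⟩
    · have h1 := Finset.card_insert_le u₁ (S₁ ∪ S₂)
      have h2 := Finset.card_union_le S₁ S₂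
      omega
    · exact mem_reach.mpr (Or.inr ⟨u₁, by simp, mem_nbrU.mpr hxy⟩)
    · exact reach_mono (Finset.subset_union_right.trans (Finset.subset_insert _ _)) hw₂
    · rintro rfl
      omega
  · rcases y with v₁ | y
    swap
    · exact absurd hxy (hG.not_adj_inr _ _)
    rcases z with v₂ | z
    swap
    · exact absurd hxz (hG.not_adj_inr _ _)
    have hT := mem_of_inr_mem_inducedVerts hG (mem_inducedVerts_of_mem_sampleBall hx)
    rw [show ballLevel G T o (Sum.inl v₂) = ballLevel G T o (Sum.inl v₁) by omega] at hz2
    have hmr : ballLevel G T o (Sum.inl v₁) ≤ r := by omega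
    obtain ⟨S₁, a1, a2, a3, a4, a5⟩ := exists_grown_of_mem_sampleBall hG (hgood' hmr) hy2
    obtain ⟨S₂, b1, b2, b3, b4, b5⟩ := exists_grown_of_mem_sampleBall hG (hgood' hmr) hz2
    have hv₁ : v₁ ∈ reach G {o} S₁ := by simpa using a5
    have hv₂ : v₂ ∈ reach G {o} S₂ := by simpa using b5
    refine ⟨S₁ ∪ S₂, a1.union b1, Finset.union_subset a2 b2, ?_, v₁,
      reach_mono Finset.subset_union_left hv₁, v₂, reach_mono Finset.subset_union_right hv₂,
      fun h => hyz (by rw [h]), u, hT, hgood _ hx, ?_, mem_nbrU.mpr hxy.symm,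
      mem_nbrU.mpr hxz.symm⟩
    · have h2 := Finset.card_union_le S₁ S₂
      omega
    · intro hmem
      have : Sum.inr u ∈ sampleBall G T o (ballLevel G T o (Sum.inl v₁)) :=
        (Finset.mem_union.mp hmem).elim (a4 u) (b4 u)
      have := ballLevel_le this
      omega

theorem sampleBallGraph_isTree (hG : IsBiregularC4Free G d k) {T : Finset U} {o : V} {r : ℕ}
    (ho : Sum.inl o ∈ inducedVerts G T)
    (hgood : ∀ u, Sum.inr u ∈ sampleBall G T o r → u ∈ good)
    (hcol : ¬ HasCollision G good o T (2 * r)) : (sampleBallGraph G T o r).IsTree := by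
  refine isTree_of_level (fun x => ballLevel G T o x.1) ⟨Sum.inl o, root_mem_sampleBall ho r⟩
    ?_ ?_ ?_
  · rintro ⟨x, hx⟩ hne
    have hpos : ballLevel G T o x ≠ 0 := fun h0 => by
      have h1 := mem_sampleBall_ballLevel hx
      rw [h0] at h1
      exact hne (Subtype.ext (mem_sampleBall_zero h1))
    obtain ⟨m, hm⟩ := Nat.exists_eq_succ_of_ne_zero hpos
    obtain ⟨y, hy, hyx, hym⟩ := exists_adj_ballLevel hx hm
    have := ballLevel_le hx
    refine ⟨⟨y, sampleBall_mono (by omega) hy⟩, hyx.symm, ?_⟩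
    change ballLevel G T o y < ballLevel G T o x
    omega
  · rintro ⟨x, hx⟩ ⟨y, hy⟩ hxy
    exact ballLevel_ne_of_adj hG hx hy hxy
  · rintro ⟨x, hx⟩ ⟨y, hy⟩ ⟨z, hz⟩ hxy hxz hly hlz
    by_contra hne
    exact hcol (hasCollision_of_two_parents hG hgood hx hy hz hxy hxz hly hlz
      fun h => hne (Subtype.ext h))

-- The grown sets S ⊆ T with |S| ≤ r, together with what they reach, cover the ball; each covers at
-- most 1 + (k+1)r + r vertices.
open Classical in
theorem ncard_sampleBall_le (hG : IsBiregularC4Free G d k) {T : Finset U} {o : V} {r : ℕ}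
    (hgood : ∀ u, Sum.inr u ∈ sampleBall G T o r → u ∈ good) :
    (sampleBall G T o r).ncard ≤ (1 + (k + 1) * r + r) *
      ∑ m ∈ Finset.range (r + 1), ((grownFamily G good {o} m).filter (· ⊆ T)).card := by
  let f : Finset U → Finset (V ⊕ U) := fun S => (reach G {o} S).disjSum S
  have hsub : sampleBall G T o r ⊆ (((Finset.range (r + 1)).biUnion fun m =>
      ((grownFamily G good {o} m).filter (· ⊆ T)).biUnion f : Finset (V ⊕ U)) : Set (V ⊕ U)) := by
    intro x hx
    obtain ⟨S, h1, h2, h3, -, h5⟩ := exists_grown_of_mem_sampleBall hG hgood hx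
    simp only [Finset.coe_biUnion, Set.mem_iUnion]
    refine ⟨S.card, by simpa using Nat.lt_succ_of_le h3, S,
      Finset.mem_coe.mpr (Finset.mem_filter.mpr ⟨mem_grownFamily.mpr ⟨h1, rfl⟩, h2⟩), ?_⟩
    rcases x with v | u
    · simpa [f] using h5
    · simpa [f] using h5
  refine (Set.ncard_le_ncard hsub (Finset.finite_toSet _)).trans ?_
  rw [Set.ncard_coe_finset, Finset.mul_sum]
  refine Finset.card_biUnion_le.trans (Finset.sum_le_sum fun m hm => ?_)
  rw [mul_comm]
  refine Finset.card_biUnion_le_card_mul _ _ _ fun S hS => ?_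
  have hc := (mem_grownFamily.mp (Finset.mem_filter.mp hS).1).2
  have hm' : m ≤ r := Nat.lt_succ_iff.mp (Finset.mem_range.mp hm)
  rw [Finset.card_disjSum]
  have h1 := card_reach_le (W := {o}) hG S
  rw [Finset.card_singleton, hc] at h1
  have := Nat.mul_le_mul_left (k + 1) hm'
  omega

end Grown

/-! ### First-moment bounds. -/

section FirstMoment

variable {V U : Type*} [Fintype V] [Nonempty V] [Fintype U] [DecidableEq U]
  {G : SimpleGraph (V ⊕ U)} {B : Matrix V U ℝ} {good : Set U} {d k : ℕ} {q C : ℝ}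

theorem projMatrix_diag_nonneg (H : Submodule ℝ (EuclideanSpace ℝ U)) (u : U) :
    0 ≤ projMatrix H u u := (projMatrix_posSemidef H).diag_nonneg

omit [Nonempty V] in
/-- The union bound for events of the form "`𝒯` contains one of the sets `Q i`". -/
theorem realProb_le_sum_prod {ι : Type*} {E : V → Finset U → Prop} (I : V → Finset ι)
    (Q : ι → Finset U) (h : ∀ o T, E o T → ∃ i ∈ I o, Q i ⊆ T) :
    realProb B E ≤
      (∑ o, ∑ i ∈ I o, ∏ u ∈ Q i, projMatrix (rowSpace B) u u) / Fintype.card V := by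
  classical
  refine div_le_div_of_nonneg_right ?_ (Nat.cast_nonneg _)
  refine Finset.sum_le_sum fun o _ => ?_
  calc _ ≤ ∑ T, ∑ i ∈ I o, (if Q i ⊆ T then detWeight (rowSpace B) T else 0) := by
        refine Finset.sum_le_sum fun T _ => ?_
        have h0 : ∀ i ∈ I o, 0 ≤ (if Q i ⊆ T then detWeight (rowSpace B) T else 0) :=
          fun i _ => by
            split_ifs
            exacts [detWeight_nonneg _ _, le_rfl]
        split_ifs with hE
        · obtain ⟨i, hi, hQ⟩ := h o T hE
          refine le_trans ?_ (Finset.single_le_sum h0 hi)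
          rw [if_pos hQ]
        · exact Finset.sum_nonneg h0
    _ = ∑ i ∈ I o, ∑ T, (if Q i ⊆ T then detWeight (rowSpace B) T else 0) := Finset.sum_comm
    _ ≤ _ := Finset.sum_le_sum fun i _ => sum_detWeight_superset_le _ _

omit [Nonempty V] in
theorem prod_projMatrix_le_of_mem_grownFamily
    (hq : ∀ u ∈ good, projMatrix (rowSpace B) u u ≤ q) {W : Finset V} {m : ℕ} {S : Finset U}
    (hS : S ∈ grownFamily G good W m) : ∏ u ∈ S, projMatrix (rowSpace B) u u ≤ q ^ m := by
  obtain ⟨h1, h2⟩ := mem_grownFamily.mp hS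
  rw [← h2, ← Finset.prod_const]
  exact Finset.prod_le_prod (fun u _ => projMatrix_diag_nonneg _ u)
    fun u hu => hq u (h1.subset_good u hu)

-- The central balance: the d choices per added vertex are offset by the probability q = O(1/d) of
-- its presence.
omit [Nonempty V] in
theorem card_grownFamily_mul_le (hG : IsBiregularC4Free G d k) (hq0 : 0 ≤ q) (hC : d * q ≤ C)
    {A m : ℕ} {W : Finset V} (hA : W.card + (k + 1) * m ≤ A) :
    ((grownFamily G good W m).card : ℝ) * q ^ m ≤ (A * C) ^ m := by
  have h1 : ((grownFamily G good W m).card : ℝ) ≤ ((d : ℝ) * A) ^ m := by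
    exact_mod_cast card_grownFamily_le (good := good) hG hA
  calc _ ≤ ((d : ℝ) * A) ^ m * q ^ m := mul_le_mul_of_nonneg_right h1 (pow_nonneg hq0 _)
    _ = (A * (d * q)) ^ m := by rw [← mul_pow]; ring
    _ ≤ _ := by gcongr

-- Mass transport: after exchanging sums, each bad u and grown S around it serve at most A roots.
-- Since S consists of good vertices, u ∉ S, and the weight factors as p_u q^m.
open Classical in
omit [Nonempty V] in
theorem realProb_not_good_le (hG : IsBiregularC4Free G d k) (hq0 : 0 ≤ q)
    (hq : ∀ u ∈ good, projMatrix (rowSpace B) u u ≤ q) (hC : d * q ≤ C) {A r : ℕ}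
    (hA : (k + 1) + (k + 1) * r ≤ A) :
    realProb B (fun o T => ∃ u, Sum.inr u ∈ sampleBall G T o r ∧ u ∉ good) ≤
      (∑ u with u ∉ good, projMatrix (rowSpace B) u u) *
        (A * ∑ m ∈ Finset.range (r + 1), (A * C) ^ m) / Fintype.card V := by
  let J : Finset (Σ _ : U, Σ _ : ℕ, Finset U) := (Finset.univ.filter (· ∉ good)).sigma fun u =>
    (Finset.range (r + 1)).sigma fun m => grownFamily G good (nbrV G u) m
  refine (realProb_le_sum_prod (fun o => J.filter fun i => o ∈ reach G (nbrV G i.1) i.2.2)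
    (fun i => insert i.1 i.2.2) ?_).trans ?_
  · rintro o T ⟨u, hu, hbad⟩
    obtain ⟨u, hT, hbad, S, h1, h2, h3, h4⟩ := exists_grown_of_not_good hG hu hbad
    refine ⟨⟨u, S.card, S⟩, ?_, Finset.insert_subset hT h2⟩
    simp only [J, Finset.mem_filter, Finset.mem_sigma, Finset.mem_univ, true_and,
      Finset.mem_range, mem_grownFamily]
    exact ⟨⟨hbad, by omega, h1, trivial⟩, h4⟩
  · refine div_le_div_of_nonneg_right ?_ (Nat.cast_nonneg _)
    have hp := fun u => projMatrix_diag_nonneg (rowSpace B) u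
    simp_rw [Finset.sum_filter (s := J)]
    rw [Finset.sum_comm, Finset.sum_mul]
    have hterm : ∀ i ∈ J, (∑ o : V, if o ∈ reach G (nbrV G i.1) i.2.2 then
        ∏ u ∈ insert i.1 i.2.2, projMatrix (rowSpace B) u u else 0) ≤
        projMatrix (rowSpace B) i.1 i.1 * (A * q ^ i.2.1) := by
      rintro ⟨u, m, S⟩ hi
      simp only [J, Finset.mem_sigma, Finset.mem_filter, Finset.mem_univ, true_and,
        Finset.mem_range] at hi
      obtain ⟨hbad, hm, hS⟩ := hi
      obtain ⟨h1, h2⟩ := mem_grownFamily.mp hS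
      have hnot : u ∉ S := fun h => hbad (h1.subset_good u h)
      have hcard : ((reach G (nbrV G u) S).card : ℝ) ≤ A := by
        have h3 := card_reach_le (W := nbrV G u) hG S
        rw [hG.card_nbrV, h2] at h3
        have := Nat.mul_le_mul_left (k + 1) (Nat.lt_succ_iff.mp hm)
        exact_mod_cast h3.trans (by omega)
      rw [Finset.sum_ite_mem, Finset.univ_inter, Finset.sum_const, nsmul_eq_mul,
        Finset.prod_insert hnot, mul_left_comm]
      refine mul_le_mul_of_nonneg_left ?_ (hp u)
      exact mul_le_mul hcard (prod_projMatrix_le_of_mem_grownFamily hq hS)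
        (Finset.prod_nonneg fun _ _ => hp _) (Nat.cast_nonneg _)
    refine (Finset.sum_le_sum hterm).trans ?_
    rw [Finset.sum_sigma]
    refine Finset.sum_le_sum fun u _ => ?_
    dsimp only
    rw [← Finset.mul_sum, ← Finset.mul_sum, Finset.sum_sigma]
    refine mul_le_mul_of_nonneg_left (mul_le_mul_of_nonneg_left ?_ (Nat.cast_nonneg _)) (hp u)
    refine Finset.sum_le_sum fun m hm => ?_
    dsimp only
    rw [Finset.sum_const, nsmul_eq_mul]
    refine card_grownFamily_mul_le hG hq0 hC ?_
    rw [hG.card_nbrV]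
    have := Nat.mul_le_mul_left (k + 1) (Nat.lt_succ_iff.mp (Finset.mem_range.mp hm))
    omega

open Classical in
/-- The pairs of vertices reached by `S` together with a new common neighbour. -/
noncomputable def collisionTriples (G : SimpleGraph (V ⊕ U)) (o : V) (S : Finset U) :
    Finset ((V × V) × U) :=
  ((reach G {o} S ×ˢ reach G {o} S) ×ˢ Finset.univ).filter fun x =>
    x.1.1 ≠ x.1.2 ∧ x.2 ∉ S ∧ x.2 ∈ nbrU G x.1.1 ∧ x.2 ∈ nbrU G x.1.2

-- By C₄-freeness a pair of reached vertices determines the new common neighbour.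
omit [Nonempty V] in
theorem card_collisionTriples_le (hG : IsBiregularC4Free G d k) (o : V) (S : Finset U) :
    (collisionTriples G o S).card ≤ (reach G {o} S).card ^ 2 := by
  classical
  rw [sq, ← Finset.card_product]
  refine Finset.card_le_card_of_injOn Prod.fst (fun x hx => ?_) fun x hx y hy hxy => ?_
  · exact (Finset.mem_product.mp (Finset.mem_filter.mp hx).1).1
  · obtain ⟨h1, -, h2, h3⟩ := (Finset.mem_filter.mp hx).2
    obtain ⟨-, -, h4, h5⟩ := (Finset.mem_filter.mp hy).2
    rw [← hxy] at h4 h5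
    exact Prod.ext hxy (hG.eq_of_common h1 h2 h3 h4 h5)

/-- The colliding vertex has at most A² positions, not order d, so its factor q survives
uncompensated. -/
theorem realProb_hasCollision_le (hG : IsBiregularC4Free G d k) (hq0 : 0 ≤ q)
    (hq : ∀ u ∈ good, projMatrix (rowSpace B) u u ≤ q) (hC : d * q ≤ C) {A M : ℕ}
    (hA : 1 + (k + 1) * M ≤ A) :
    realProb B (fun o T => HasCollision G good o T M) ≤
      (A ^ 2 * ∑ m ∈ Finset.range (M + 1), (A * C) ^ m) * q := by
  classical
  have hV : (0 : ℝ) < Fintype.card V := by exact_mod_cast Fintype.card_pos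
  let J : V → Finset (Σ _ : ℕ, Σ _ : Finset U, (V × V) × U) := fun o =>
    (Finset.range (M + 1)).sigma fun m => (grownFamily G good {o} m).sigma fun S =>
      (collisionTriples G o S).filter (·.2 ∈ good)
  refine (realProb_le_sum_prod J (fun i => insert i.2.2.2 i.2.1) ?_).trans ?_
  · rintro o T ⟨S, h1, h2, h3, v, hv, w, hw, hvw, u, hT, hu, huS, huv, huw⟩
    refine ⟨⟨S.card, S, (v, w), u⟩, ?_, Finset.insert_subset hT h2⟩
    simp only [J, Finset.mem_filter, Finset.mem_sigma, Finset.mem_range, mem_grownFamily,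
      collisionTriples, Finset.mem_product, Finset.mem_univ, and_true]
    exact ⟨by omega, h1, ⟨⟨hv, hw⟩, hvw, huS, huv, huw⟩, hu⟩
  · rw [div_le_iff₀ hV]
    have hp := fun u => projMatrix_diag_nonneg (rowSpace B) u
    have key : ∀ o : V, (∑ i ∈ J o, ∏ u ∈ insert i.2.2.2 i.2.1, projMatrix (rowSpace B) u u) ≤
        (A ^ 2 * ∑ m ∈ Finset.range (M + 1), (A * C) ^ m) * q := by
      intro o
      rw [Finset.sum_sigma, Finset.mul_sum, Finset.sum_mul]
      refine Finset.sum_le_sum fun m hm => ?_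
      have hm' := Nat.mul_le_mul_left (k + 1) (Nat.lt_succ_iff.mp (Finset.mem_range.mp hm))
      have hAm : ({o} : Finset V).card + (k + 1) * m ≤ A := by
        rw [Finset.card_singleton]; omega
      rw [Finset.sum_sigma]
      have hS : ∀ S ∈ grownFamily G good {o} m,
          (∑ x ∈ (collisionTriples G o S).filter (·.2 ∈ good),
            ∏ u ∈ insert x.2 S, projMatrix (rowSpace B) u u) ≤ (A : ℝ) ^ 2 * (q * q ^ m) := by
        intro S hS
        have hx : ∀ x ∈ (collisionTriples G o S).filter (·.2 ∈ good),
            ∏ u ∈ insert x.2 S, projMatrix (rowSpace B) u u ≤ q * q ^ m := by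
          intro x hx
          obtain ⟨h1, h2⟩ := Finset.mem_filter.mp hx
          rw [Finset.prod_insert (Finset.mem_filter.mp h1).2.2.1]
          exact mul_le_mul (hq _ h2) (prod_projMatrix_le_of_mem_grownFamily hq hS)
            (Finset.prod_nonneg fun _ _ => hp _) hq0
        refine (Finset.sum_le_card_nsmul _ _ _ hx).trans ?_
        rw [nsmul_eq_mul]
        refine mul_le_mul_of_nonneg_right ?_ (by positivity)
        have h1 := (Finset.card_filter_le _ (·.2 ∈ good)).trans
          (card_collisionTriples_le hG o S)
        have h2 := card_reach_le (W := {o}) hG S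
        rw [(mem_grownFamily.mp hS).2] at h2
        exact_mod_cast h1.trans (Nat.pow_le_pow_left (h2.trans hAm) 2)
      refine (Finset.sum_le_card_nsmul _ _ _ hS).trans ?_
      rw [nsmul_eq_mul]
      have := card_grownFamily_mul_le (good := good) hG hq0 hC hAm
      calc _ = (A : ℝ) ^ 2 * (((grownFamily G good {o} m).card : ℝ) * q ^ m) * q := by ring
        _ ≤ _ := by gcongr
    refine (Finset.sum_le_sum fun o _ => key o).trans ?_
    simp [mul_comm]

/-- Markov's inequality for the number of grown sets contained in 𝒯. -/
theorem realProb_lt_ncard_le (hG : IsBiregularC4Free G d k) (hq0 : 0 ≤ q)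
    (hq : ∀ u ∈ good, projMatrix (rowSpace B) u u ≤ q) (hC : d * q ≤ C) {A r t : ℕ}
    (hA : 1 + (k + 1) * r ≤ A) (ht : 0 < t) :
    realProb B (fun o T => (∀ u, Sum.inr u ∈ sampleBall G T o r → u ∈ good) ∧
      t < (sampleBall G T o r).ncard) ≤
      ((A + r) * ∑ m ∈ Finset.range (r + 1), (A * C) ^ m) / t := by
  classical
  have ht' : (0 : ℝ) < t := by exact_mod_cast ht
  refine realProb_le_of_forall B fun o => ?_
  rw [le_div_iff₀ ht', Finset.sum_mul]
  let X : Finset U → ℕ := fun T =>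
    ∑ m ∈ Finset.range (r + 1), ((grownFamily G good {o} m).filter (· ⊆ T)).card
  have hX : ∑ T, detWeight (rowSpace B) T * X T ≤
      ∑ m ∈ Finset.range (r + 1), (A * C) ^ m := by
    have h1 : ∀ T, detWeight (rowSpace B) T * X T = ∑ m ∈ Finset.range (r + 1),
        ∑ S ∈ grownFamily G good {o} m, if S ⊆ T then detWeight (rowSpace B) T else 0 := by
      intro T
      simp only [X, Nat.cast_sum, Finset.mul_sum]
      refine Finset.sum_congr rfl fun m _ => ?_
      rw [← Finset.sum_filter, Finset.sum_const, nsmul_eq_mul, mul_comm]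
    rw [Finset.sum_congr rfl fun T _ => h1 T, Finset.sum_comm]
    refine Finset.sum_le_sum fun m hm => ?_
    have hm' := Nat.mul_le_mul_left (k + 1) (Nat.lt_succ_iff.mp (Finset.mem_range.mp hm))
    have hAm : ({o} : Finset V).card + (k + 1) * m ≤ A := by
      rw [Finset.card_singleton]; omega
    rw [Finset.sum_comm]
    refine (Finset.sum_le_card_nsmul _ _ (q ^ m) fun S hS =>
      (sum_detWeight_superset_le _ _).trans
        (prod_projMatrix_le_of_mem_grownFamily hq hS)).trans ?_
    rw [nsmul_eq_mul]
    exact card_grownFamily_mul_le hG hq0 hC hAm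
  calc _ ≤ ∑ T, (A + r : ℝ) * (detWeight (rowSpace B) T * X T) := by
        refine Finset.sum_le_sum fun T _ => ?_
        have hw := detWeight_nonneg (rowSpace B) T
        split_ifs with hE
        · have h1 : t ≤ (A + r) * X T := by
            refine (hE.2.le.trans (ncard_sampleBall_le hG hE.1)).trans ?_
            exact Nat.mul_le_mul_right _ (by omega)
          have h2 : (t : ℝ) ≤ (A + r) * X T := by exact_mod_cast h1
          calc _ ≤ detWeight (rowSpace B) T * ((A + r) * X T) :=
                mul_le_mul_of_nonneg_left h2 hw
            _ = _ := by ring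
        · rw [zero_mul]; positivity
    _ ≤ _ := by
        rw [← Finset.mul_sum]
        exact mul_le_mul_of_nonneg_left hX (by positivity)

end FirstMoment

/-! ### Bounds for fixed n, with the unstructured vertices as the good ones. -/

section Quantitative

variable {V U : Type*} [Fintype V] [Nonempty V] [Fintype U] [DecidableEq U]
  {G : SimpleGraph (V ⊕ U)} {d k : ℕ} {B : Matrix V U ℝ} {lam : Fin B.rank → ℝ}
  {ψ : Fin B.rank → EuclideanSpace ℝ U} {ε δ : ℝ}

/-- A bound for the expected number of small grown sets contained in the sample. -/
noncomputable def momentSum (k A r : ℕ) : ℝ :=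
  ∑ m ∈ Finset.range (r + 1), ((A : ℝ) * (2 * (k + 1) + 1)) ^ m

theorem momentSum_nonneg (k A r : ℕ) : 0 ≤ momentSum k A r :=
  Finset.sum_nonneg fun _ _ => by positivity

-- The summand 2(k+1) comes from eigenvalues near 1, the extra 1 from the exceptional mass δ ≤ 1/d.
omit [Nonempty V] in
theorem IsPositiveEigensystem.projMatrix_le_of_notMem (h : IsPositiveEigensystem d B lam ψ)
    (hB : IsSignedAdjMatrix G B) (hG : IsBiregularC4Free G d k) (hd : 0 < d)
    (hε' : ε ≤ 1 / 4) (hδd : δ * d ≤ 1) :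
    ∀ u ∈ (structuredSet lam ψ ε δ)ᶜ,
      projMatrix (rowSpace B) u u ≤ (2 * (k + 1) + 1) / d := by
  intro u hu
  have hd' : (0 : ℝ) < d := by exact_mod_cast hd
  have h1 : ∑ i with ε < (lam i - 1) ^ 2, ψ i u ^ 2 ≤ δ := not_lt.mp hu
  have h2 := h.projMatrix_diag_le hB hG hε' u
  have h3 : δ ≤ 1 / d := by rwa [le_div_iff₀ hd']
  rw [add_div, mul_div_assoc]
  linarith

theorem IsPositiveEigensystem.realProb_structured_le (h : IsPositiveEigensystem d B lam ψ)
    (hB : IsSignedAdjMatrix G B) (hG : IsBiregularC4Free G d k) (hd : 0 < d) (hε : 0 < ε)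
    (hε' : ε ≤ 1 / 4) (hδ : 0 < δ) (hδd : δ * d ≤ 1) {A r : ℕ}
    (hA : (k + 1) + (k + 1) * r ≤ A) :
    realProb B (fun o T => ∃ u, Sum.inr u ∈ sampleBall G T o r ∧
      u ∉ (structuredSet lam ψ ε δ)ᶜ) ≤
      (2 * (k + 1) * k / (ε * δ * (d : ℝ) ^ 2) + k / (ε * d)) * (A * momentSum k A r) := by
  classical
  have hd' : (0 : ℝ) < d := by exact_mod_cast hd
  have hV : (0 : ℝ) < Fintype.card V := by exact_mod_cast Fintype.card_pos
  refine (realProb_not_good_le (C := 2 * (k + 1) + 1) hG (by positivity)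
    (h.projMatrix_le_of_notMem hB hG hd hε' hδd) (by field_simp; rfl) hA).trans ?_
  rw [div_le_iff₀ hV]
  have h1 := h.sum_structured_le hB hG hd hε hε' hδ
  refine (mul_le_mul_of_nonneg_right (le_of_eq_of_le (Finset.sum_congr ?_ fun _ _ => rfl) h1)
    (mul_nonneg (Nat.cast_nonneg A) (momentSum_nonneg k A r))).trans_eq ?_
  · ext u
    simp
  · ring

theorem IsPositiveEigensystem.realProb_lt_ncard_le (h : IsPositiveEigensystem d B lam ψ)
    (hB : IsSignedAdjMatrix G B) (hG : IsBiregularC4Free G d k) (hd : 0 < d) (hε : 0 < ε)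
    (hε' : ε ≤ 1 / 4) (hδ : 0 < δ) (hδd : δ * d ≤ 1) {A r t : ℕ}
    (hA : (k + 1) + (k + 1) * r ≤ A) (ht : 0 < t) :
    realProb B (fun o T => t < (sampleBall G T o r).ncard) ≤
      (2 * (k + 1) * k / (ε * δ * (d : ℝ) ^ 2) + k / (ε * d)) * (A * momentSum k A r) +
        (A + r) * momentSum k A r / t := by
  have hd' : (0 : ℝ) < d := by exact_mod_cast hd
  refine le_trans (realProb_mono B (F := fun o T =>
    (∃ u, Sum.inr u ∈ sampleBall G T o r ∧ u ∉ (structuredSet lam ψ ε δ)ᶜ) ∨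
    ((∀ u, Sum.inr u ∈ sampleBall G T o r → u ∈ (structuredSet lam ψ ε δ)ᶜ) ∧
      t < (sampleBall G T o r).ncard)) fun o T _ hE => ?_) ?_
  · by_cases hs : ∃ u, Sum.inr u ∈ sampleBall G T o r ∧ u ∉ (structuredSet lam ψ ε δ)ᶜ
    · exact Or.inl hs
    · push Not at hs
      exact Or.inr ⟨hs, hE⟩
  · refine (realProb_or_le B _ _).trans (add_le_add
      (h.realProb_structured_le hB hG hd hε hε' hδ hδd hA) ?_)
    exact DetProc.realProb_lt_ncard_le (C := 2 * (k + 1) + 1) hG (by positivity)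
      (h.projMatrix_le_of_notMem hB hG hd hε' hδd) (by field_simp; rfl) (by omega) ht

/-- Three failures: a structured vertex in the ball, an untouched root (its ball is empty, hence not
a tree; the term k/d), or a collision. -/
theorem IsPositiveEigensystem.realProb_not_isTree_le (h : IsPositiveEigensystem d B lam ψ)
    (hB : IsSignedAdjMatrix G B) (hG : IsBiregularC4Free G d k) (hd : 0 < d) (hε : 0 < ε)
    (hε' : ε ≤ 1 / 4) (hδ : 0 < δ) (hδd : δ * d ≤ 1) {A r : ℕ}
    (hA : (k + 1) + (k + 1) * (2 * r) ≤ A) :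
    realProb B (fun o T => ¬ (sampleBallGraph G T o r).IsTree) ≤
      (2 * (k + 1) * k / (ε * δ * (d : ℝ) ^ 2) + k / (ε * d)) * (A * momentSum k A r) +
        (k / d + A ^ 2 * momentSum k A (2 * r) * ((2 * (k + 1) + 1) / d)) := by
  have hd' : (0 : ℝ) < d := by exact_mod_cast hd
  have hr : (k + 1) * r ≤ (k + 1) * (2 * r) := Nat.mul_le_mul_left _ (by omega)
  refine le_trans (realProb_mono B (F := fun o T =>
    (∃ u, Sum.inr u ∈ sampleBall G T o r ∧ u ∉ (structuredSet lam ψ ε δ)ᶜ) ∨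
    (Sum.inl o ∉ inducedVerts G T ∨ HasCollision G (structuredSet lam ψ ε δ)ᶜ o T (2 * r)))
    fun o T _ hE => ?_) ?_
  · by_contra hs
    rw [not_or, not_or, not_not] at hs
    obtain ⟨h1, h2, h3⟩ := hs
    push Not at h1
    exact hE (sampleBallGraph_isTree hG h2 h1 h3)
  · refine (realProb_or_le B _ _).trans (add_le_add
      (h.realProb_structured_le hB hG hd hε hε' hδ hδd (by omega)) ?_)
    refine (realProb_or_le B _ _).trans (add_le_add
      (realProb_not_mem_inducedVerts_le h hB hG hd) ?_)
    exact realProb_hasCollision_le (C := 2 * (k + 1) + 1) hG (by positivity)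
      (h.projMatrix_le_of_notMem hB hG hd hε' hδd) (by field_simp; rfl) (by omega)

end Quantitative
end DetProc

/-! ### Passage to the limit. -/

theorem theorem2p2 (k : ℕ) (hk : 1 ≤ k)
    (V U : ℕ → Type*) [∀ n, Fintype (V n)] [∀ n, Nonempty (V n)]
    [∀ n, Fintype (U n)] [∀ n, DecidableEq (U n)]
    (d : ℕ → ℕ) (hd : Tendsto d atTop atTop)
    (G : ∀ n, SimpleGraph (V n ⊕ U n))
    (hG : ∀ n, DetProc.IsBiregularC4Free (G n) (d n) k)
    (B : ∀ n, Matrix (V n) (U n) ℝ)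
    (hB : ∀ n, DetProc.IsSignedAdjMatrix (G n) (B n))
    (lam : ∀ n, Fin (B n).rank → ℝ)
    (ψ : ∀ n, Fin (B n).rank → EuclideanSpace ℝ (U n))
    (hψ : ∀ n, DetProc.IsPositiveEigensystem (d n) (B n) (lam n) (ψ n))
    (ε δ : ℕ → ℝ) (hεpos : ∀ n, 0 < ε n) (hδpos : ∀ n, 0 < δ n)
    (hε : Tendsto ε atTop (𝓝 0))
    (hεd : Tendsto (fun n => ε n * d n) atTop atTop)
    (hδd : Tendsto (fun n => δ n * d n) atTop (𝓝 0))
    (hεδd : Tendsto (fun n => ε n * δ n * (d n : ℝ) ^ 2) atTop atTop)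
    (r : ℕ) (hr : 0 < r) :
    Tendsto (fun t : ℕ => limsup (fun n =>
        DetProc.prob (B n) fun o T => t < (DetProc.sampleBall (G n) T o r).ncard) atTop)
      atTop (𝓝 0) ∧
    Tendsto (fun n =>
        DetProc.prob (B n) fun o T => (DetProc.sampleBallGraph (G n) T o r).IsTree)
      atTop (𝓝 1) ∧
    Tendsto (fun n =>
        DetProc.prob (B n) fun o T =>
          (DetProc.sampleBall (G n) T o r ∩
            Sum.inr '' DetProc.structuredSet (lam n) (ψ n) (ε n) (δ n)).Nonempty)
      atTop (𝓝 0) := by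
  -- Bounds the number of vertices reached in every exploration used: at most k + 1 initial ones,
  -- and k + 1 for each of at most 2r added vertices.
  set A : ℕ := (k + 1) + (k + 1) * (2 * r) with hA
  have hAr : (k + 1) + (k + 1) * r ≤ A := by
    have : (k + 1) * r ≤ (k + 1) * (2 * r) := Nat.mul_le_mul_left _ (by omega)
    omega
  have hdR : Tendsto (fun n => (d n : ℝ)) atTop atTop := tendsto_natCast_atTop_atTop.comp hd
  have hd0 : ∀ᶠ n in atTop, 0 < d n := hd.eventually_gt_atTop 0
  have hε4 : ∀ᶠ n in atTop, ε n ≤ 1 / 4 := hε.eventually_le_const (by norm_num)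
  have hδ1 : ∀ᶠ n in atTop, δ n * d n ≤ 1 := hδd.eventually_le_const one_pos
  set β : ℕ → ℝ := fun n =>
    (2 * (k + 1) * k / (ε n * δ n * (d n : ℝ) ^ 2) + k / (ε n * d n)) *
      (A * DetProc.momentSum k A r) with hβ
  have hβ0 : Tendsto β atTop (𝓝 0) := by
    have := ((hεδd.const_div_atTop (2 * (k + 1) * k : ℝ)).add
      (hεd.const_div_atTop (k : ℝ))).mul_const (A * DetProc.momentSum k A r)
    simpa using this
  refine ⟨?_, ?_, ?_⟩
  · set L : ℝ := (A + r) * DetProc.momentSum k A r with hL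
    have hlim : Tendsto (fun t : ℕ => ENNReal.ofReal (L / t)) atTop (𝓝 0) := by
      have := ENNReal.tendsto_ofReal (tendsto_const_div_atTop_nhds_zero_nat L)
      rwa [ENNReal.ofReal_zero] at this
    refine tendsto_of_tendsto_of_tendsto_of_le_of_le' tendsto_const_nhds hlim
      (Eventually.of_forall fun _ => zero_le) ?_
    filter_upwards [eventually_gt_atTop 0] with t ht
    -- At fixed t the structured contribution β vanishes as n → ∞, leaving the Markov bound L/t for
    -- the outer limit.
    have hn : Tendsto (fun n => ENNReal.ofReal (β n + L / t)) atTop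
        (𝓝 (ENNReal.ofReal (L / t))) := by
      have := ENNReal.tendsto_ofReal (hβ0.add_const (L / t))
      rwa [zero_add] at this
    rw [← hn.limsup_eq]
    refine limsup_le_limsup ?_
    filter_upwards [hd0, hε4, hδ1] with n h1 h2 h3
    rw [DetProc.prob_eq_ofReal]
    exact ENNReal.ofReal_le_ofReal ((hψ n).realProb_lt_ncard_le (hB n) (hG n) h1 (hεpos n) h2
      (hδpos n) h3 hAr ht)
  · set γ : ℕ → ℝ := fun n => β n + ((k : ℝ) / d n + A ^ 2 * DetProc.momentSum k A (2 * r) *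
      ((2 * (k + 1) + 1) / d n)) with hγ
    have hγ0 : Tendsto γ atTop (𝓝 0) := by
      have := hβ0.add ((hdR.const_div_atTop (k : ℝ)).add
        ((hdR.const_div_atTop (2 * (k + 1) + 1 : ℝ)).const_mul
          (A ^ 2 * DetProc.momentSum k A (2 * r))))
      simpa using this
    have hlow : Tendsto (fun n => ENNReal.ofReal (1 - γ n)) atTop (𝓝 1) := by
      have := ENNReal.tendsto_ofReal (hγ0.const_sub 1)
      simpa using this
    refine tendsto_of_tendsto_of_tendsto_of_le_of_le' hlow tendsto_const_nhds ?_ ?_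
    · filter_upwards [hd0, hε4, hδ1] with n h1 h2 h3
      rw [DetProc.prob_eq_ofReal]
      refine ENNReal.ofReal_le_ofReal ?_
      have h4 := (hψ n).realProb_not_isTree_le (hB n) (hG n) h1 (hεpos n) h2 (hδpos n) h3
        (r := r) hA.ge
      have h5 := DetProc.realProb_add_not (B n)
        fun o T => (DetProc.sampleBallGraph (G n) T o r).IsTree
      have h6 : γ n = β n + ((k : ℝ) / d n + A ^ 2 * DetProc.momentSum k A (2 * r) *
        ((2 * (k + 1) + 1) / d n)) := rfl
      linarith
    · refine Eventually.of_forall fun n => ?_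
      rw [DetProc.prob_eq_ofReal, ← ENNReal.ofReal_one]
      refine ENNReal.ofReal_le_ofReal ?_
      have h5 := DetProc.realProb_add_not (B n)
        fun o T => (DetProc.sampleBallGraph (G n) T o r).IsTree
      have h6 := DetProc.realProb_nonneg (B n)
        fun o T => ¬ (DetProc.sampleBallGraph (G n) T o r).IsTree
      linarith
  · have hlim : Tendsto (fun n => ENNReal.ofReal (β n)) atTop (𝓝 0) := by
      have := ENNReal.tendsto_ofReal hβ0
      rwa [ENNReal.ofReal_zero] at this
    refine tendsto_of_tendsto_of_tendsto_of_le_of_le' tendsto_const_nhds hlim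
      (Eventually.of_forall fun _ => zero_le) ?_
    filter_upwards [hd0, hε4, hδ1] with n h1 h2 h3
    rw [DetProc.prob_eq_ofReal]
    refine ENNReal.ofReal_le_ofReal (le_trans (DetProc.realProb_mono _ fun o T _ hE => ?_)
      ((hψ n).realProb_structured_le (hB n) (hG n) h1 (hεpos n) h2 (hδpos n) h3 hAr))
    obtain ⟨_, hx, u, hu, rfl⟩ := hE
    exact ⟨u, hx, fun h => h hu⟩
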